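/- Let $d\ge 1$, $n\ge 0$. Let the kinematic state have density $\mathcal N(x\mid m,P)$ on $\mathbb R^{n}$ with $P$ symmetric positive definite, and let the extent matrix $X_k$ have the inverse Wishart density on symmetric positive definite $d\times d$ matrices $$\mathcal{IW}_d(X\mid\nu,V)=\frac{\exp(-\tfrac12\operatorname{tr}(VX^{-1}))\,|V|^{(\nu-d-1)/2}}{2^{d(\nu-d-1)/2}\,\Gamma_d(\tfrac{\nu-d-1}{2})\,|X|^{\nu/2}}$$ with parameters $\nu=\nu_{k|k}>2d+2$ (so that its expectation exists) and $V=V_{k|k}$ symmetric positive definite; here $|\cdot|$ is the determinant and $\Gamma_d$ the multivariate Gamma function. Let $Q$ be symmetric positive definite $d\times d$, let $x\mapsto M_x$ be a function on $\mathbb R^n$ with values in the nonsingular $d\times d$ matrices, put $\bar V=V(I+QV)^{-1}$, and assume that the integrals $$C_1=\int (M_x\bar VM_x^T)^{-1}\mathcal N(x\mid m,P)\,dx,\qquad C_2=\int M_x\bar VM_x^T\,\mathcal N(x\mid m,P)\,dx$$ converge absolutely. Set $$v_{k+1}=2d+2+(\nu_{k|k}-2d-2)\,|I+QV|^{-1/d},\qquad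 \rho=v_{k+1}-2d-2,$$ $$\nu_{k+1|k}=2d+2+\frac{(d+1)\rho}{(\rho+d+1)|C_1C_2|^{1/d}-\rho},\qquad V_{k+1|k}=\frac{\nu_{k+1|k}-d-1}{v_{k+1}-d-1}\,C_1^{-1},$$ and let the predicted extent $X_{k+1}$ have density $\mathcal{IW}_d(\cdot\mid\nu_{k+1|k},V_{k+1|k})$. Let $H=(I+QV)^{-1}|I+QV|^{1/d}$. Then $|H|=1$; $\nu_{k+1|k}>2d+2$ and $V_{k+1|k}$ is positive definite; the expectations $\mathbb E[X_k]$, $\mathbb E[X_{k+1}]$ and the integral below exist; $\mathbb E[X_{k+1}]$ and that integral are symmetric positive definite; and $$\operatorname{Vol}\big(\mathbb E[X_{k+1}]\big)=\operatorname{Vol}\Big(\int M_x\,\mathbb E[X_k]\,H\,M_x^T\,\mathcal N(x\mid m,P)\,dx\Big),$$ where $\operatorname{Vol}(X)$ is the volume of the ellipsoid $\{y\in\mathbb R^d: y^TX^{-1}y\le 1\}$. -/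

import Mathlib

open MeasureTheory Matrix

noncomputable section

namespace ExtentPrediction

/-- The density `N(x | m, P)` on `ℝⁿ` of the Gaussian law with mean `m` and covariance `P`. -/
def gaussianPdf {n : ℕ} (m : Fin n → ℝ) (P : Matrix (Fin n) (Fin n) ℝ) (x : Fin n → ℝ) : ℝ :=
  Real.exp (-(1 / 2) * ((x - m) ⬝ᵥ (P⁻¹ *ᵥ (x - m)))) /
    ((2 * Real.pi) ^ ((n : ℝ) / 2) * P.det ^ ((1 : ℝ) / 2))

/-- The multivariate Gamma function `Γ_d(a) = π^{d(d-1)/4} ∏_{i=1}^{d} Γ(a - (i-1)/2)`. -/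
def multiGamma (d : ℕ) (a : ℝ) : ℝ :=
  Real.pi ^ ((d : ℝ) * ((d : ℝ) - 1) / 4) * ∏ i : Fin d, Real.Gamma (a - (i : ℝ) / 2)

/-- The density `IW_d(X | ν, V)` of the inverse Wishart law, as a function of `X`. -/
def invWishartPdf {d : ℕ} (ν : ℝ) (V X : Matrix (Fin d) (Fin d) ℝ) : ℝ :=
  Real.exp (-(1 / 2) * (V * X⁻¹).trace) * V.det ^ ((ν - d - 1) / 2) /
    ((2 : ℝ) ^ ((d : ℝ) * (ν - d - 1) / 2) * multiGamma d ((ν - d - 1) / 2) * X.det ^ (ν / 2))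

/-- The symmetric matrix with entries `x_{ij}`, one free coordinate for each unordered pair
`{i, j}`. Lebesgue measure on these `d(d+1)/2` coordinates is the measure `dX = ∏_{i ≤ j} dx_{ij}`
on symmetric matrices. -/
def symMat {d : ℕ} (x : Sym2 (Fin d) → ℝ) : Matrix (Fin d) (Fin d) ℝ :=
  Matrix.of fun i j => x s(i, j)

/-- The coordinates of the cone of symmetric positive definite matrices. -/
def posDefCone (d : ℕ) : Set (Sym2 (Fin d) → ℝ) := {x | (symMat x).PosDef}

/-- All entries of `X` are integrable under the inverse Wishart law `IW_d(ν, V)`. -/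
def InvWishartMeanExists {d : ℕ} (ν : ℝ) (V : Matrix (Fin d) (Fin d) ℝ) : Prop :=
  ∀ i j, IntegrableOn (fun x => symMat x i j * invWishartPdf ν V (symMat x)) (posDefCone d)

/-- The expectation `∫_{X > 0} X IW_d(X | ν, V) dX` of the inverse Wishart law. -/
def invWishartMean {d : ℕ} (ν : ℝ) (V : Matrix (Fin d) (Fin d) ℝ) : Matrix (Fin d) (Fin d) ℝ :=
  Matrix.of fun i j => ∫ x in posDefCone d, symMat x i j * invWishartPdf ν V (symMat x)

/-- All entries of `F` are integrable against `N(x | m, P) dx`. -/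
def GaussianIntegrable {n d : ℕ} (m : Fin n → ℝ) (P : Matrix (Fin n) (Fin n) ℝ)
    (F : (Fin n → ℝ) → Matrix (Fin d) (Fin d) ℝ) : Prop :=
  ∀ i j, Integrable (fun x => F x i j * gaussianPdf m P x)

/-- The matrix `∫ F(x) N(x | m, P) dx`, entry by entry. -/
def gaussianIntegral {n d : ℕ} (m : Fin n → ℝ) (P : Matrix (Fin n) (Fin n) ℝ)
    (F : (Fin n → ℝ) → Matrix (Fin d) (Fin d) ℝ) : Matrix (Fin d) (Fin d) ℝ :=
  Matrix.of fun i j => ∫ x, F x i j * gaussianPdf m P x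

/-- The ellipsoid `{y : yᵀ X⁻¹ y ≤ 1}` in `ℝᵈ` described by the extent matrix `X`. -/
def ellipsoid {d : ℕ} (X : Matrix (Fin d) (Fin d) ℝ) : Set (Fin d → ℝ) :=
  {y | y ⬝ᵥ (X⁻¹ *ᵥ y) ≤ 1}

/-- `Vol(X)`: the Lebesgue measure of the ellipsoid described by `X`. -/
def Vol {d : ℕ} (X : Matrix (Fin d) (Fin d) ℝ) : ENNReal := volume (ellipsoid X)

/-- The transition degrees of freedom
`v_{k+1} = 2d + 2 + (ν_{k|k} - 2d - 2) |I + Q V_{k|k}|^{-1/d}`. -/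
def transDof {d : ℕ} (ν : ℝ) (V Q : Matrix (Fin d) (Fin d) ℝ) : ℝ :=
  2 * d + 2 + (ν - 2 * d - 2) * (1 + Q * V).det ^ (-(1 : ℝ) / d)

/-- The intermediate parameter matrix `V_{k|k} (I + Q V_{k|k})⁻¹`. -/
def Vbar {d : ℕ} (V Q : Matrix (Fin d) (Fin d) ℝ) : Matrix (Fin d) (Fin d) ℝ :=
  V * (1 + Q * V)⁻¹

/-- `x ↦ M_x V̄ M_xᵀ`. -/
def scaleAt {n d : ℕ} (M : (Fin n → ℝ) → Matrix (Fin d) (Fin d) ℝ)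
    (V Q : Matrix (Fin d) (Fin d) ℝ) (x : Fin n → ℝ) : Matrix (Fin d) (Fin d) ℝ :=
  M x * Vbar V Q * (M x)ᵀ

/-- `C₁ = ∫ (M_x V̄ M_xᵀ)⁻¹ N(x | m, P) dx`. -/
def C₁ {n d : ℕ} (m : Fin n → ℝ) (P : Matrix (Fin n) (Fin n) ℝ)
    (M : (Fin n → ℝ) → Matrix (Fin d) (Fin d) ℝ) (V Q : Matrix (Fin d) (Fin d) ℝ) :
    Matrix (Fin d) (Fin d) ℝ :=
  gaussianIntegral m P fun x => (scaleAt M V Q x)⁻¹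

/-- `C₂ = ∫ M_x V̄ M_xᵀ N(x | m, P) dx`. -/
def C₂ {n d : ℕ} (m : Fin n → ℝ) (P : Matrix (Fin n) (Fin n) ℝ)
    (M : (Fin n → ℝ) → Matrix (Fin d) (Fin d) ℝ) (V Q : Matrix (Fin d) (Fin d) ℝ) :
    Matrix (Fin d) (Fin d) ℝ :=
  gaussianIntegral m P fun x => scaleAt M V Q x

/-- The predicted degrees of freedom
`ν_{k+1|k} = 2d + 2 + (d+1) ρ / ((ρ + d + 1) |C₁ C₂|^{1/d} - ρ)` with `ρ = v - 2d - 2`,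
for transition degrees of freedom `v`. -/
def predDof {n d : ℕ} (v : ℝ) (m : Fin n → ℝ) (P : Matrix (Fin n) (Fin n) ℝ)
    (M : (Fin n → ℝ) → Matrix (Fin d) (Fin d) ℝ) (V Q : Matrix (Fin d) (Fin d) ℝ) : ℝ :=
  let ρ : ℝ := v - 2 * d - 2
  2 * d + 2 + (d + 1) * ρ /
    ((ρ + d + 1) * (C₁ m P M V Q * C₂ m P M V Q).det ^ ((1 : ℝ) / d) - ρ)

/-- The predicted parameter matrix
`V_{k+1|k} = ((ν_{k+1|k} - d - 1) / (v - d - 1)) C₁⁻¹`, for transition degrees of freedom `v`. -/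
def predParam {n d : ℕ} (v : ℝ) (m : Fin n → ℝ) (P : Matrix (Fin n) (Fin n) ℝ)
    (M : (Fin n → ℝ) → Matrix (Fin d) (Fin d) ℝ) (V Q : Matrix (Fin d) (Fin d) ℝ) :
    Matrix (Fin d) (Fin d) ℝ :=
  ((predDof v m P M V Q - d - 1) / (v - d - 1)) • (C₁ m P M V Q)⁻¹

/-- `H = (I + Q V_{k|k})⁻¹ |I + Q V_{k|k}|^{1/d}`. -/
def shapeH {d : ℕ} (V Q : Matrix (Fin d) (Fin d) ℝ) : Matrix (Fin d) (Fin d) ℝ :=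
  (1 + Q * V).det ^ ((1 : ℝ) / d) • (1 + Q * V)⁻¹

end ExtentPrediction

end

noncomputable section

namespace ExtentPrediction

/-! ### Gaussian and inverse Gamma integrals. -/

section Analysis

/-! The inverse Wishart law `IW(ν, V)` has mean `V / (ν - 2d - 2)` (`invWishartMean_eq`); granted
this, the volume identity is algebra. By the choice of `H` and `ρ`, the right-hand integrand is `ρ⁻¹
M_x V̄ M_xᵀ`, so the integral is `ρ⁻¹ C₂`. With `k = |C₁C₂|^{1/d}`, the definition of `ν_{k+1|k}` is
exactly what makes the predicted mean `(k/ρ) C₁⁻¹`. Both matrices have determinant `ρ^{-d} |C₂|`,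
and `Vol X` depends on `X` only through `|X|` (`Vol_eq`).

The predicted parameters are admissible because `k ≥ 1`. Jensen's inequality for matrix inversion
gives `C₂⁻¹ ≤ C₁` as quadratic forms, hence `|C₁C₂| ≥ 1`, and the denominator `(ρ + d + 1)k - ρ` is
positive.

Most of the work is the mean. A positive definite `X` is written as `[s + uᵀSu, (Su)ᵀ; Su, S]` with
Schur complement `s > 0`. In these coordinates the Jacobian is `|S|`, `|X| = s|S|`, and `tr(VX⁻¹)`
splits into a part in `(s, u)` and `tr(WS⁻¹)`, where `W` is the corresponding block of `V`.
Integrating `u` (Gaussian) and `s` (inverse Gamma) leaves the same problem for `S` with `ν - 2`.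
Induction on `d` yields the normalizing constant and the mean of the last diagonal entry. The action
`X ↦ AXAᵀ` carries that entry to any quadratic form, and polarization recovers all entries. The
computation runs in `ENNReal`, so that integrability comes with the values. -/

open scoped MatrixOrder in
theorem exists_eq_mul_transpose {ι : Type*} [Fintype ι] [DecidableEq ι] {A : Matrix ι ι ℝ}
    (hA : A.PosDef) : ∃ B : Matrix ι ι ℝ, B.det ≠ 0 ∧ A = B * Bᵀ := by
  have hnn : (0 : Matrix ι ι ℝ) ≤ A := hA.posSemidef.nonneg
  have hs : (CFC.sqrt A)ᵀ = CFC.sqrt A := by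
    have h := (CFC.sqrt_nonneg A).posSemidef.isHermitian
    rwa [IsHermitian, conjTranspose_eq_transpose_of_trivial] at h
  have hB : A = CFC.sqrt A * (CFC.sqrt A)ᵀ := by
    rw [hs, CFC.sqrt_mul_sqrt_self A hnn]
  refine ⟨CFC.sqrt A, fun h => ?_, hB⟩
  have h1 := hA.det_pos
  rw [hB, det_mul, h, zero_mul] at h1
  exact lt_irrefl _ h1

theorem lintegral_comp_mulVec {n : ℕ} {A : Matrix (Fin n) (Fin n) ℝ} (hA : A.det ≠ 0)
    {f : (Fin n → ℝ) → ENNReal} (hf : Measurable f) :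
    ∫⁻ x, f (A *ᵥ x) = ENNReal.ofReal |A.det|⁻¹ * ∫⁻ x, f x := by
  have h := Real.map_matrix_volume_pi_eq_smul_volume_pi hA
  have hm : Measurable (Matrix.toLin' A) :=
    (LinearMap.continuous_of_finiteDimensional _).measurable
  have := lintegral_map (μ := volume) hf hm
  rw [h, lintegral_smul_measure] at this
  simpa [abs_inv] using this.symm

theorem lintegral_gaussian_std (n : ℕ) :
    ∫⁻ x : Fin n → ℝ, ENNReal.ofReal (Real.exp (-(1 / 2) * (x ⬝ᵥ x))) =
      ENNReal.ofReal ((2 * Real.pi) ^ ((n : ℝ) / 2)) := by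
  have h1 : (fun x : Fin n → ℝ => Real.exp (-(1 / 2) * (x ⬝ᵥ x))) =
      fun x => ∏ i, Real.exp (-(1 / 2) * (x i) ^ 2) := by
    funext x
    rw [← Real.exp_sum, dotProduct, Finset.mul_sum]
    simp [pow_two]
  have hint : Integrable (fun x : Fin n → ℝ => ∏ i, Real.exp (-(1 / 2) * (x i) ^ 2)) :=
    Integrable.fintype_prod (f := fun _ (y : ℝ) => Real.exp (-(1 / 2) * y ^ 2))
      fun _ => integrable_exp_neg_mul_sq (by norm_num)
  rw [← h1] at hint
  rw [← ofReal_integral_eq_lintegral_ofReal hint (ae_of_all _ fun x => (Real.exp_pos _).le), h1,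
    volume_pi, integral_fintype_prod_eq_prod (fun _ (y : ℝ) => Real.exp (-(1 / 2) * y ^ 2))]
  congr 1
  simp only [integral_gaussian, Finset.prod_const, Finset.card_univ, Fintype.card_fin]
  rw [Real.sqrt_eq_rpow, ← Real.rpow_natCast, ← Real.rpow_mul (by positivity)]
  congr 1 <;> ring

/-- The Gaussian integral with a positive definite quadratic form. -/
theorem lintegral_gaussian {n : ℕ} {A : Matrix (Fin n) (Fin n) ℝ} (hA : A.PosDef)
    (m : Fin n → ℝ) :
    ∫⁻ x : Fin n → ℝ, ENNReal.ofReal (Real.exp (-(1 / 2) * ((x - m) ⬝ᵥ (A *ᵥ (x - m))))) =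
      ENNReal.ofReal ((2 * Real.pi) ^ ((n : ℝ) / 2) * A.det ^ (-(1 : ℝ) / 2)) := by
  rw [lintegral_sub_right_eq_self
    (fun x => ENNReal.ofReal (Real.exp (-(1 / 2) * (x ⬝ᵥ (A *ᵥ x))))) m]
  -- With `A = BBᵀ`, the substitution `y = Bᵀx` reduces to the standard Gaussian.
  obtain ⟨B, hB, rfl⟩ := exists_eq_mul_transpose hA
  have h := lintegral_comp_mulVec (A := Bᵀ) (by simpa using hB)
    (f := fun x => ENNReal.ofReal (Real.exp (-(1 / 2) * (x ⬝ᵥ x)))) (by fun_prop)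
  rw [lintegral_gaussian_std] at h
  have h2 : ∀ x, x ⬝ᵥ ((B * Bᵀ) *ᵥ x) = (Bᵀ *ᵥ x) ⬝ᵥ (Bᵀ *ᵥ x) := fun x => by
    rw [← mulVec_mulVec, dotProduct_mulVec, ← mulVec_transpose]
  simp only [h2]
  rw [h, ← ENNReal.ofReal_mul (by positivity), mul_comm]
  congr 2
  rw [det_mul, det_transpose, neg_div, Real.rpow_neg (mul_self_nonneg _), ← Real.sqrt_eq_rpow,
    Real.sqrt_mul_self_eq_abs]

/-- The substitution `t = s⁻¹` turns this into Euler's integral for `Γ(a)`. -/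
theorem lintegral_inverseGamma {a b : ℝ} (ha : 0 < a) (hb : 0 < b) :
    ∫⁻ s in Set.Ioi (0 : ℝ), ENNReal.ofReal (s ^ (-(a + 1)) * Real.exp (-(b / s))) =
      ENNReal.ofReal (b ^ (-a) * Real.Gamma a) := by
  have hg : IntegrableOn (fun t : ℝ => t ^ (a - 1) * Real.exp (-(b * t))) (Set.Ioi 0) := by
    have := integrableOn_rpow_mul_exp_neg_mul_rpow (p := 1) (s := a - 1) (by linarith) one_pos hb
    simpa using this
  have heq : Set.EqOn (fun s : ℝ => (|(-1 : ℝ)| * s ^ ((-1 : ℝ) - 1)) •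
      ((s ^ (-1 : ℝ)) ^ (a - 1) * Real.exp (-(b * s ^ (-1 : ℝ)))))
      (fun s => s ^ (-(a + 1)) * Real.exp (-(b / s))) (Set.Ioi 0) := by
    intro s hs
    have hs : (0 : ℝ) < s := hs
    simp only [abs_neg, abs_one, one_mul, smul_eq_mul]
    rw [← Real.rpow_mul hs.le, ← mul_assoc, ← Real.rpow_add hs, Real.rpow_neg_one, div_eq_mul_inv]
    congr 2
    ring
  have h1 := integral_comp_rpow_Ioi (fun t : ℝ => t ^ (a - 1) * Real.exp (-(b * t)))
    (p := -1) (by norm_num)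
  have h2 := (integrableOn_Ioi_comp_rpow_iff (fun t : ℝ => t ^ (a - 1) * Real.exp (-(b * t)))
    (p := -1) (by norm_num)).2 hg
  rw [setIntegral_congr_fun measurableSet_Ioi heq, Real.integral_rpow_mul_exp_neg_mul_Ioi ha hb]
    at h1
  have h3 := (integrableOn_congr_fun heq measurableSet_Ioi).1 h2
  rw [← ofReal_integral_eq_lintegral_ofReal h3, h1, one_div, Real.inv_rpow hb.le,
    Real.rpow_neg hb.le]
  filter_upwards [ae_restrict_mem measurableSet_Ioi] with s hs
  have hs : (0 : ℝ) < s := hs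
  positivity

end Analysis

/-! ### Schur complements of bordered matrices. -/

section Bordered

variable {d : ℕ}

/-- The matrix with corner `a`, border `b` and lower right block `S`. -/
def bordered (a : ℝ) (b : Fin d → ℝ) (S : Matrix (Fin d) (Fin d) ℝ) :
    Matrix (Fin (d + 1)) (Fin (d + 1)) ℝ :=
  Matrix.of (Fin.cons (Fin.cons a b) fun i => Fin.cons (b i) (S i))

/-- The unipotent matrix with first row `(1, u)`. -/
def shear (u : Fin d → ℝ) : Matrix (Fin (d + 1)) (Fin (d + 1)) ℝ :=
  Matrix.of (Fin.cons (Fin.cons 1 u) fun i => Fin.cons 0 ((1 : Matrix (Fin d) (Fin d) ℝ) i))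

@[simp] theorem bordered_zero_zero (a : ℝ) (b : Fin d → ℝ) (S : Matrix (Fin d) (Fin d) ℝ) :
    bordered a b S 0 0 = a := rfl

@[simp] theorem bordered_zero_succ (a : ℝ) (b : Fin d → ℝ) (S : Matrix (Fin d) (Fin d) ℝ)
    (j : Fin d) : bordered a b S 0 j.succ = b j := rfl

@[simp] theorem bordered_succ_zero (a : ℝ) (b : Fin d → ℝ) (S : Matrix (Fin d) (Fin d) ℝ)
    (i : Fin d) : bordered a b S i.succ 0 = b i := rfl

@[simp] theorem bordered_succ_succ (a : ℝ) (b : Fin d → ℝ) (S : Matrix (Fin d) (Fin d) ℝ)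
    (i j : Fin d) : bordered a b S i.succ j.succ = S i j := rfl

@[simp] theorem shear_zero_zero (u : Fin d → ℝ) : shear u 0 0 = 1 := rfl

@[simp] theorem shear_zero_succ (u : Fin d → ℝ) (j : Fin d) : shear u 0 j.succ = u j := rfl

@[simp] theorem shear_succ_zero (u : Fin d → ℝ) (i : Fin d) : shear u i.succ 0 = 0 := rfl

@[simp] theorem shear_succ_succ (u : Fin d → ℝ) (i j : Fin d) :
    shear u i.succ j.succ = (1 : Matrix (Fin d) (Fin d) ℝ) i j := rfl

theorem bordered_submatrix_succ (a : ℝ) (b : Fin d → ℝ) (S : Matrix (Fin d) (Fin d) ℝ) :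
    (bordered a b S).submatrix Fin.succ Fin.succ = S := rfl

theorem shear_mul_shear (u w : Fin d → ℝ) : shear u * shear w = shear (u + w) := by
  ext i j
  refine Fin.cases ?_ (fun i => ?_) i <;> refine Fin.cases ?_ (fun j => ?_) j <;>
    simp [mul_apply, Fin.sum_univ_succ, one_apply, add_comm]

theorem shear_zero : shear (0 : Fin d → ℝ) = 1 := by
  ext i j
  refine Fin.cases ?_ (fun i => ?_) i <;> refine Fin.cases ?_ (fun j => ?_) j <;>
    simp [one_apply, Fin.succ_ne_zero, (Fin.succ_ne_zero _).symm]

theorem shear_inv (u : Fin d → ℝ) : (shear u)⁻¹ = shear (-u) :=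
  inv_eq_right_inv (by rw [shear_mul_shear, add_neg_cancel, shear_zero])

theorem det_shear (u : Fin d → ℝ) : (shear u).det = 1 := by
  rw [det_succ_column_zero, Fin.sum_univ_succ]
  simp only [shear_zero_zero, shear_succ_zero, mul_zero, zero_mul, Finset.sum_const_zero, add_zero,
    Fin.val_zero, pow_zero, one_mul]
  exact det_one

theorem isUnit_shear (u : Fin d → ℝ) : IsUnit (shear u) := by
  rw [isUnit_iff_isUnit_det, det_shear]
  exact isUnit_one

/-- Block diagonalization by a unipotent congruence. It reduces the determinant, definiteness and
inverse of a bordered matrix to the case of zero border. -/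
theorem shear_mul_bordered_mul {S : Matrix (Fin d) (Fin d) ℝ} (hS : Sᵀ = S) (s : ℝ)
    (u : Fin d → ℝ) :
    shear u * bordered s 0 S * (shear u)ᵀ = bordered (s + u ⬝ᵥ (S *ᵥ u)) (S *ᵥ u) S := by
  have hS' : ∀ i j, S i j = S j i := fun i j => by
    conv_lhs => rw [← hS]
    rfl
  ext i j
  refine Fin.cases ?_ (fun i => ?_) i <;> refine Fin.cases ?_ (fun j => ?_) j
  · simp [mul_apply, Fin.sum_univ_succ, dotProduct, mulVec, Finset.sum_mul, Finset.mul_sum]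
    rw [Finset.sum_comm]
    exact Finset.sum_congr rfl fun _ _ => Finset.sum_congr rfl fun _ _ => by ring
  · simp [mul_apply, Fin.sum_univ_succ, dotProduct, mulVec, one_apply]
    exact Finset.sum_congr rfl fun k _ => by rw [hS' k j]; ring
  · simp [mul_apply, Fin.sum_univ_succ, dotProduct, mulVec, one_apply]
  · simp [mul_apply, Fin.sum_univ_succ, one_apply]

theorem det_bordered_zero (s : ℝ) (S : Matrix (Fin d) (Fin d) ℝ) :
    (bordered s 0 S).det = s * S.det := by
  rw [det_succ_column_zero, Fin.sum_univ_succ]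
  simp only [bordered_zero_zero, bordered_succ_zero, Pi.zero_apply, mul_zero, zero_mul,
    Finset.sum_const_zero, add_zero, Fin.val_zero, pow_zero, one_mul]
  rfl

theorem bordered_zero_inv {s : ℝ} (hs : s ≠ 0) {S : Matrix (Fin d) (Fin d) ℝ} (hS : S.det ≠ 0) :
    (bordered s 0 S)⁻¹ = bordered s⁻¹ 0 S⁻¹ := by
  have h : S * S⁻¹ = 1 := mul_nonsing_inv _ (isUnit_iff_ne_zero.2 hS)
  refine inv_eq_right_inv ?_
  ext i j
  refine Fin.cases ?_ (fun i => ?_) i <;> refine Fin.cases ?_ (fun j => ?_) j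
  · simp [mul_apply, Fin.sum_univ_succ, hs]
  · simp [mul_apply, Fin.sum_univ_succ, (Fin.succ_ne_zero _).symm]
  · simp [mul_apply, Fin.sum_univ_succ]
  · have := congrFun (congrFun h i) j
    simp only [mul_apply] at this
    simp [mul_apply, Fin.sum_univ_succ, this, one_apply]

theorem posDef_bordered_zero_iff {s : ℝ} {S : Matrix (Fin d) (Fin d) ℝ} :
    (bordered s 0 S).PosDef ↔ 0 < s ∧ S.PosDef := by
  constructor
  · intro h
    refine ⟨by simpa using h.diag_pos (i := 0), ?_⟩
    rw [← bordered_submatrix_succ s 0 S]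
    exact h.submatrix (Fin.succ_injective d)
  · rintro ⟨hs, hS⟩
    refine posDef_iff_dotProduct_mulVec.2 ⟨?_, fun x hx => ?_⟩
    · ext i j
      have := fun i j => hS.isHermitian.apply i j
      refine Fin.cases ?_ (fun i => ?_) i <;> refine Fin.cases ?_ (fun j => ?_) j <;>
        simp [conjTranspose_apply]
      simpa using this i j
    · have key : star x ⬝ᵥ (bordered s 0 S *ᵥ x) =
          s * x 0 ^ 2 + Fin.tail x ⬝ᵥ (S *ᵥ Fin.tail x) := by
        simp [dotProduct, mulVec, Fin.sum_univ_succ, Fin.tail]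
        ring
      rw [key]
      by_cases ht : Fin.tail x = 0
      · have h0 : x 0 ≠ 0 := by
          intro h0
          apply hx
          ext i
          refine Fin.cases h0 (fun i => ?_) i
          exact congrFun ht i
        rw [ht]
        simp
        positivity
      · have := hS.dotProduct_mulVec_pos ht
        simp only [star_trivial] at this
        positivity

theorem posDef_bordered_iff {s : ℝ} {u : Fin d → ℝ} {S : Matrix (Fin d) (Fin d) ℝ} (hS : S.PosDef) :
    (bordered (s + u ⬝ᵥ (S *ᵥ u)) (S *ᵥ u) S).PosDef ↔ 0 < s := by
  have ht : Sᵀ = S := by simpa using hS.isHermitian.eq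
  rw [← shear_mul_bordered_mul ht, ← conjTranspose_eq_transpose_of_trivial,
    ← star_eq_conjTranspose, (isUnit_shear u).posDef_star_right_conjugate_iff,
    posDef_bordered_zero_iff]
  exact and_iff_left hS

theorem det_bordered {s : ℝ} {u : Fin d → ℝ} {S : Matrix (Fin d) (Fin d) ℝ} (hS : Sᵀ = S) :
    (bordered (s + u ⬝ᵥ (S *ᵥ u)) (S *ᵥ u) S).det = s * S.det := by
  rw [← shear_mul_bordered_mul hS, det_mul, det_mul, det_transpose, det_shear, det_bordered_zero]
  ring

/-- Take `u = S⁻¹w` for the border `w`; then `σ` is the Schur complement of `S` in `V`. -/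
theorem exists_bordered_of_posDef {V : Matrix (Fin (d + 1)) (Fin (d + 1)) ℝ} (hV : V.PosDef) :
    ∃ (σ : ℝ) (u : Fin d → ℝ) (S : Matrix (Fin d) (Fin d) ℝ), 0 < σ ∧ S.PosDef ∧
      V = bordered (σ + u ⬝ᵥ (S *ᵥ u)) (S *ᵥ u) S := by
  have hS : (V.submatrix Fin.succ Fin.succ).PosDef := hV.submatrix (Fin.succ_injective d)
  set S := V.submatrix Fin.succ Fin.succ with hSdef
  set w : Fin d → ℝ := fun i => V i.succ 0 with hw
  have hu : S *ᵥ (S⁻¹ *ᵥ w) = w := by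
    rw [mulVec_mulVec, mul_nonsing_inv _ (isUnit_iff_ne_zero.2 hS.det_pos.ne'), one_mulVec]
  have hVeq : V = bordered ((V 0 0 - (S⁻¹ *ᵥ w) ⬝ᵥ (S *ᵥ (S⁻¹ *ᵥ w))) +
      (S⁻¹ *ᵥ w) ⬝ᵥ (S *ᵥ (S⁻¹ *ᵥ w))) (S *ᵥ (S⁻¹ *ᵥ w)) S := by
    have hsym := fun i j => hV.isHermitian.apply i j
    rw [hu]
    ext i j
    refine Fin.cases ?_ (fun i => ?_) i <;> refine Fin.cases ?_ (fun j => ?_) j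
    · simp
    · simpa [hw] using (hsym 0 j.succ).symm
    · simp [hw]
    · rfl
  refine ⟨_, _, S, ?_, hS, hVeq⟩
  rw [← posDef_bordered_iff hS, ← hVeq]
  exact hV

/-- Cyclicity of the trace merges the shears by `u₀` and `-u` into one shear by `u₀ - u` acting on
`diag(σ, W)`, which is then paired with `diag(s⁻¹, S⁻¹)`. This is what separates `(s, u)` from `S`
in the exponent. -/
theorem trace_bordered_mul_inv {σ s : ℝ} {u₀ u : Fin d → ℝ} {W S : Matrix (Fin d) (Fin d) ℝ}
    (hW : W.PosDef) (hS : S.PosDef) (hs : 0 < s) :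
    (bordered (σ + u₀ ⬝ᵥ (W *ᵥ u₀)) (W *ᵥ u₀) W *
      (bordered (s + u ⬝ᵥ (S *ᵥ u)) (S *ᵥ u) S)⁻¹).trace =
      (σ + (u - u₀) ⬝ᵥ (W *ᵥ (u - u₀))) / s + (W * S⁻¹).trace := by
  have hWt : Wᵀ = W := by simpa using hW.isHermitian.eq
  have hSt : Sᵀ = S := by simpa using hS.isHermitian.eq
  rw [← shear_mul_bordered_mul hWt, ← shear_mul_bordered_mul hSt, Matrix.mul_inv_rev,
    Matrix.mul_inv_rev, ← transpose_nonsing_inv, shear_inv,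
    bordered_zero_inv hs.ne' hS.det_pos.ne']
  have h1 : shear u₀ * bordered σ 0 W * (shear u₀)ᵀ *
      ((shear (-u))ᵀ * (bordered s⁻¹ 0 S⁻¹ * shear (-u))) =
      (shear u₀ * bordered σ 0 W * (shear u₀)ᵀ * (shear (-u))ᵀ * bordered s⁻¹ 0 S⁻¹) *
        shear (-u) := by simp only [Matrix.mul_assoc]
  have h2 : shear (-u) * (shear u₀ * bordered σ 0 W * (shear u₀)ᵀ * (shear (-u))ᵀ *
      bordered s⁻¹ 0 S⁻¹) = shear (-u + u₀) * bordered σ 0 W * (shear (-u + u₀))ᵀ *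
      bordered s⁻¹ 0 S⁻¹ := by
    rw [← shear_mul_shear, transpose_mul]
    simp only [Matrix.mul_assoc]
  rw [h1, trace_mul_comm, h2, shear_mul_bordered_mul hWt]
  have h3 : (-u + u₀) ⬝ᵥ (W *ᵥ (-u + u₀)) = (u - u₀) ⬝ᵥ (W *ᵥ (u - u₀)) := by
    rw [show -u + u₀ = -(u - u₀) by abel, mulVec_neg, neg_dotProduct_neg]
  rw [h3]
  simp [trace, Fin.sum_univ_succ, mul_apply, div_eq_mul_inv]

end Bordered

/-! ### Coordinates on symmetric matrices and integration over the cone. -/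

section Coordinates

variable {d : ℕ}

/-- Splitting the unordered pairs in `Fin (d + 1)` into those that contain `0` and the others. -/
def sym2FinSuccEquiv (d : ℕ) : (Unit ⊕ Fin d) ⊕ Sym2 (Fin d) ≃ Sym2 (Fin (d + 1)) :=
  Equiv.ofBijective
    (Sum.elim (Sum.elim (fun _ => s(0, 0)) fun i => s(0, i.succ)) (Sym2.map Fin.succ)) <| by
  constructor
  · rintro ((⟨⟩ | i) | z) ((⟨⟩ | j) | w) h
    · rfl
    · simp at h
      exact absurd h.symm (Fin.succ_ne_zero j)
    · induction w using Sym2.ind with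
      | _ a b =>
        simp at h
        rcases h with h | h
        · exact absurd h.1.symm (Fin.succ_ne_zero _)
        · exact absurd h.1.symm (Fin.succ_ne_zero _)
    · simp at h
    · simpa using h
    · induction w using Sym2.ind with
      | _ a b =>
        simp at h
        rcases h with h | h
        · exact absurd h.1.symm (Fin.succ_ne_zero _)
        · exact absurd h.1.symm (Fin.succ_ne_zero _)
    · induction z using Sym2.ind with
      | _ a b => simp at h
    · induction z using Sym2.ind with
      | _ a b => simp at h
    · exact congrArg _ (Sym2.map.injective (Fin.succ_injective d) h)
  · intro z
    induction z using Sym2.ind with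
    | _ a b =>
      refine Fin.cases ?_ (fun a => ?_) a <;> refine Fin.cases ?_ (fun b => ?_) b
      · exact ⟨Sum.inl (Sum.inl ()), rfl⟩
      · exact ⟨Sum.inl (Sum.inr b), rfl⟩
      · exact ⟨Sum.inl (Sum.inr a), Sym2.eq_swap⟩
      · exact ⟨Sum.inr s(a, b), rfl⟩

/-- The coordinates of the symmetric matrix with corner `a`, border `b` and lower right block with
coordinates `x`. -/
def borderedCoord (a : ℝ) (b : Fin d → ℝ) (x : Sym2 (Fin d) → ℝ) : Sym2 (Fin (d + 1)) → ℝ :=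
  fun z => Sum.elim (Sum.elim (fun _ => a) b) x ((sym2FinSuccEquiv d).symm z)

theorem symMat_borderedCoord (a : ℝ) (b : Fin d → ℝ) (x : Sym2 (Fin d) → ℝ) :
    symMat (borderedCoord a b x) = bordered a b (symMat x) := by
  have key : ∀ w, borderedCoord a b x (sym2FinSuccEquiv d w) =
      Sum.elim (Sum.elim (fun _ => a) b) x w := fun w => by simp [borderedCoord]
  ext i j
  refine Fin.cases ?_ (fun i => ?_) i <;> refine Fin.cases ?_ (fun j => ?_) j
  · exact key (Sum.inl (Sum.inl ()))
  · exact key (Sum.inl (Sum.inr j))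
  · rw [symMat, of_apply, Sym2.eq_swap]
    exact key (Sum.inl (Sum.inr i))
  · exact key (Sum.inr s(i, j))

theorem symMat_transpose (x : Sym2 (Fin d) → ℝ) : (symMat x)ᵀ = symMat x := by
  ext i j
  simp [symMat, Sym2.eq_swap]

theorem symMat_injective : Function.Injective (symMat (d := d)) := by
  intro x y h
  funext z
  induction z using Sym2.ind with
  | _ i j => exact congrFun (congrFun h i) j

theorem measurable_symMat_apply (i j : Fin d) : Measurable fun x => symMat x i j :=
  measurable_pi_apply _

theorem continuous_symMat : Continuous (symMat (d := d)) :=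
  continuous_matrix fun _ _ => continuous_apply _

/-- Positive definite means positive semidefinite (a closed condition) and invertible (an open one).
-/
theorem measurableSet_posDefCone (d : ℕ) : MeasurableSet (posDefCone d) := by
  have h : posDefCone d = (⋂ v : Fin d → ℝ, {x | 0 ≤ v ⬝ᵥ (symMat x *ᵥ v)}) ∩
      {x | (symMat x).det ≠ 0} := by
    ext x
    have hherm : (symMat x).IsHermitian := by
      rw [IsHermitian, conjTranspose_eq_transpose_of_trivial, symMat_transpose]
    simp only [posDefCone, Set.mem_ofPred_eq, Set.mem_inter_iff, Set.mem_iInter]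
    constructor
    · exact fun hx => ⟨fun v => by simpa using hx.posSemidef.dotProduct_mulVec_nonneg v,
        hx.det_pos.ne'⟩
    · rintro ⟨h1, h2⟩
      have hps : (symMat x).PosSemidef :=
        PosSemidef.of_dotProduct_mulVec_nonneg hherm fun v => by simpa using h1 v
      exact hps.posDef_iff_isUnit.2 ((isUnit_iff_isUnit_det _).2 (isUnit_iff_ne_zero.2 h2))
  rw [h]
  refine (IsClosed.measurableSet (isClosed_iInter fun v => ?_)).inter ?_
  · exact isClosed_le continuous_const
      (continuous_const.dotProduct (continuous_symMat.matrix_mulVec continuous_const))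
  · exact (isOpen_ne_fun continuous_symMat.matrix_det continuous_const).measurableSet

/-- The inverse is the adjugate divided by the determinant, also for singular matrices, where both
sides are zero by convention. -/
theorem measurable_trace_mul_symMat_inv (V : Matrix (Fin d) (Fin d) ℝ) :
    Measurable fun x => (V * (symMat x)⁻¹).trace := by
  have h : (fun x => (V * (symMat x)⁻¹).trace) =
      fun x => ((symMat x).det)⁻¹ * (V * (symMat x).adjugate).trace := by
    funext x
    rw [inv_def, Ring.inverse_eq_inv', mul_smul_comm, trace_smul, smul_eq_mul]
  rw [h]
  exact continuous_symMat.matrix_det.measurable.inv.mul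
    (continuous_const.matrix_mul continuous_symMat.matrix_adjugate).matrix_trace.measurable

theorem measurable_borderedCoord :
    Measurable fun p : ((Sym2 (Fin d) → ℝ) × (Fin d → ℝ)) × ℝ =>
      borderedCoord p.2 p.1.2 p.1.1 := by
  refine measurable_pi_lambda _ fun z => ?_
  unfold borderedCoord
  rcases (sym2FinSuccEquiv d).symm z with (_ | i) | w <;> simp only [Sum.elim_inl, Sum.elim_inr] <;>
    fun_prop

/-- Tonelli after a relabelling of coordinates; each unordered pair occurs once, so no constant
appears. -/
theorem lintegral_eq_borderedCoord {F : (Sym2 (Fin (d + 1)) → ℝ) → ENNReal} (hF : Measurable F) :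
    ∫⁻ y, F y = ∫⁻ x, ∫⁻ b, ∫⁻ a, F (borderedCoord a b x) := by
  have e1 := (volume_measurePreserving_piCongrLeft (fun _ => ℝ) (sym2FinSuccEquiv d))
  have e2 := (volume_measurePreserving_sumPiEquivProdPi_symm
    (fun _ : (Unit ⊕ Fin d) ⊕ Sym2 (Fin d) => ℝ))
  have e3 := (volume_measurePreserving_sumPiEquivProdPi_symm
    (fun _ : Unit ⊕ Fin d => ℝ))
  have e4 := (volume_preserving_funUnique Unit ℝ).symm
  have hF₁ : Measurable fun y => F (MeasurableEquiv.piCongrLeft (fun _ => ℝ)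
      (sym2FinSuccEquiv d) y) := hF.comp (MeasurableEquiv.measurable _)
  rw [← e1.lintegral_comp hF, ← e2.lintegral_comp hF₁,
    Measure.volume_eq_prod, lintegral_prod_symm']
  swap
  · exact hF₁.comp (MeasurableEquiv.measurable _)
  refine lintegral_congr fun x => ?_
  have hG : Measurable fun q : Unit ⊕ Fin d → ℝ =>
      F (MeasurableEquiv.piCongrLeft (fun _ => ℝ) (sym2FinSuccEquiv d)
        ((MeasurableEquiv.sumPiEquivProdPi fun _ => ℝ).symm (q, x))) :=
    (hF₁.comp (MeasurableEquiv.measurable _)).comp measurable_prodMk_right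
  rw [← e3.lintegral_comp hG, Measure.volume_eq_prod, lintegral_prod_symm']
  swap
  · exact hG.comp (MeasurableEquiv.measurable _)
  refine lintegral_congr fun b => ?_
  rw [← e4.lintegral_comp]
  swap
  · exact (hG.comp (MeasurableEquiv.measurable _)).comp measurable_prodMk_right
  refine lintegral_congr fun a => congrArg F ?_
  funext z
  obtain ⟨w, rfl⟩ := (sym2FinSuccEquiv d).surjective z
  rw [MeasurableEquiv.coe_piCongrLeft, Equiv.piCongrLeft_apply_apply]
  unfold borderedCoord
  rw [Equiv.symm_apply_apply]
  rcases w with (_ | i) | w <;> rfl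

/-- Integration over the positive definite cone in the coordinates
`X = [s + uᵀSu, (Su)ᵀ; Su, S]`. -/
theorem lintegral_posDefCone_succ {F : (Sym2 (Fin (d + 1)) → ℝ) → ENNReal} (hF : Measurable F) :
    ∫⁻ y in posDefCone (d + 1), F y =
      ∫⁻ x in posDefCone d, ENNReal.ofReal (symMat x).det * ∫⁻ u, ∫⁻ s in Set.Ioi (0 : ℝ),
        F (borderedCoord (s + u ⬝ᵥ (symMat x *ᵥ u)) (symMat x *ᵥ u) x) := by
  rw [← lintegral_indicator (measurableSet_posDefCone _),
    ← lintegral_indicator (measurableSet_posDefCone _),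
    lintegral_eq_borderedCoord (hF.indicator (measurableSet_posDefCone _))]
  refine lintegral_congr fun x => ?_
  by_cases hx : x ∈ posDefCone d
  swap
  -- A principal block of a positive definite matrix is positive definite, so nothing lies over `x`
  -- outside the smaller cone.
  · rw [Set.indicator_of_notMem hx, lintegral_eq_zero_iff']
    · refine ae_of_all _ fun b => ?_
      simp only [Pi.zero_apply]
      rw [lintegral_eq_zero_of_ae_eq_zero]
      refine ae_of_all _ fun a => Set.indicator_of_notMem (fun h => hx ?_) _
      have h : (symMat (borderedCoord a b x)).PosDef := h
      rw [symMat_borderedCoord] at h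
      change (symMat x).PosDef
      rw [← bordered_submatrix_succ a b (symMat x)]
      exact h.submatrix (Fin.succ_injective d)
    · refine Measurable.aemeasurable (Measurable.lintegral_prod_right'
        (f := fun p : (Fin d → ℝ) × ℝ => (posDefCone (d + 1)).indicator F
          (borderedCoord p.2 p.1 x)) ?_)
      exact (hF.indicator (measurableSet_posDefCone _)).comp
        (measurable_borderedCoord.comp (f := fun p : (Fin d → ℝ) × ℝ => ((x, p.1), p.2))
          (by fun_prop))
  · rw [Set.indicator_of_mem hx]
    have hS : (symMat x).PosDef := hx
    have hdet := hS.det_pos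
    have hmeas : Measurable fun b => ∫⁻ a, (posDefCone (d + 1)).indicator F
        (borderedCoord a b x) := by
      refine (Measurable.lintegral_prod_right'
        (f := fun p : (Fin d → ℝ) × ℝ => (posDefCone (d + 1)).indicator F
          (borderedCoord p.2 p.1 x)) ?_)
      exact (hF.indicator (measurableSet_posDefCone _)).comp
        (measurable_borderedCoord.comp (f := fun p : (Fin d → ℝ) × ℝ => ((x, p.1), p.2))
          (by fun_prop))
    -- The substitution `b = Su` produces the Jacobian `|S|`; the corner is then translated by
    -- `uᵀSu`.
    have h := lintegral_comp_mulVec hdet.ne' hmeas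
    have hc : ENNReal.ofReal (symMat x).det * ENNReal.ofReal |(symMat x).det|⁻¹ = 1 := by
      rw [← ENNReal.ofReal_mul hdet.le, abs_of_pos hdet, mul_inv_cancel₀ hdet.ne',
        ENNReal.ofReal_one]
    rw [← one_mul (∫⁻ b, _), ← hc, mul_assoc, ← h]
    congr 1
    refine lintegral_congr fun u => ?_
    rw [← lintegral_add_right_eq_self _ (u ⬝ᵥ (symMat x *ᵥ u)),
      ← lintegral_indicator measurableSet_Ioi]
    refine lintegral_congr fun s => ?_
    have hiff : borderedCoord (s + u ⬝ᵥ (symMat x *ᵥ u)) (symMat x *ᵥ u) x ∈ posDefCone (d + 1) ↔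
        s ∈ Set.Ioi (0 : ℝ) := by
      change (symMat _).PosDef ↔ 0 < s
      rw [symMat_borderedCoord, posDef_bordered_iff hS]
    by_cases hs : s ∈ Set.Ioi (0 : ℝ)
    · rw [Set.indicator_of_mem hs, Set.indicator_of_mem (hiff.2 hs)]
    · rw [Set.indicator_of_notMem hs, Set.indicator_of_notMem (fun h => hs (hiff.1 h))]

end Coordinates

/-! ### Splitting the unnormalized inverse Wishart density. -/

section Weight

variable {d : ℕ}

/-- The inverse Wishart density up to its normalizing constant. -/
def invWishartWeight (ν : ℝ) (V X : Matrix (Fin d) (Fin d) ℝ) : ℝ :=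
  X.det ^ (-(ν / 2)) * Real.exp (-(1 / 2) * (V * X⁻¹).trace)

theorem measurable_invWishartWeight (ν : ℝ) (V : Matrix (Fin d) (Fin d) ℝ) :
    Measurable fun x => invWishartWeight ν V (symMat x) := by
  have h := measurable_trace_mul_symMat_inv V
  have h' := (continuous_symMat (d := d)).matrix_det.measurable
  unfold invWishartWeight
  fun_prop

theorem invWishartWeight_pos (ν : ℝ) (V : Matrix (Fin d) (Fin d) ℝ)
    {X : Matrix (Fin d) (Fin d) ℝ} (hX : X.PosDef) : 0 < invWishartWeight ν V X :=
  mul_pos (Real.rpow_pos_of_pos hX.det_pos _) (Real.exp_pos _)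

theorem borderedCoord_map_succ (a : ℝ) (b : Fin d → ℝ) (x : Sym2 (Fin d) → ℝ) :
    (fun z => borderedCoord a b x (z.map Fin.succ)) = x := by
  apply symMat_injective
  exact congrArg (fun X : Matrix _ _ ℝ => X.submatrix Fin.succ Fin.succ)
    (symMat_borderedCoord a b x)

theorem lintegral_shear_kernel {W : Matrix (Fin d) (Fin d) ℝ} (hW : W.PosDef) {σ : ℝ} (hσ : 0 < σ)
    {ν : ℝ} (hν : (d : ℝ) + 2 < ν) (u₀ : Fin d → ℝ) :
    ∫⁻ u : Fin d → ℝ, ∫⁻ s in Set.Ioi (0 : ℝ), ENNReal.ofReal (s ^ (-(ν / 2)) *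
      Real.exp (-(1 / 2) * ((σ + (u - u₀) ⬝ᵥ (W *ᵥ (u - u₀))) / s))) =
    ENNReal.ofReal ((2 * Real.pi) ^ ((d : ℝ) / 2) * W.det ^ (-(1 : ℝ) / 2) *
      ((σ / 2) ^ (-((ν - d - 2) / 2)) * Real.Gamma ((ν - d - 2) / 2))) := by
  have hq : Measurable fun u : Fin d → ℝ => (u - u₀) ⬝ᵥ (W *ᵥ (u - u₀)) := by
    refine Continuous.measurable ?_
    have h : Continuous fun u : Fin d → ℝ => u - u₀ := by fun_prop
    exact h.dotProduct (continuous_const.matrix_mulVec h)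
  -- For fixed `s` the integral over `u` is Gaussian with precision `W/s`. It contributes a factor
  -- `s^{d/2}`, which leaves an inverse Gamma integral with shape `(ν - d - 2)/2`.
  rw [lintegral_lintegral_swap]
  swap
  · refine Measurable.aemeasurable ?_
    unfold Function.uncurry
    have : Measurable fun p : (Fin d → ℝ) × ℝ => (p.1 - u₀) ⬝ᵥ (W *ᵥ (p.1 - u₀)) :=
      hq.comp measurable_fst
    fun_prop
  have hinner : ∀ s ∈ Set.Ioi (0 : ℝ), ∫⁻ u : Fin d → ℝ, ENNReal.ofReal (s ^ (-(ν / 2)) *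
      Real.exp (-(1 / 2) * ((σ + (u - u₀) ⬝ᵥ (W *ᵥ (u - u₀))) / s))) =
      ENNReal.ofReal ((2 * Real.pi) ^ ((d : ℝ) / 2) * W.det ^ (-(1 : ℝ) / 2)) *
        ENNReal.ofReal (s ^ (-((ν - d - 2) / 2 + 1)) * Real.exp (-(σ / 2 / s))) := by
    intro s hs
    have hs : 0 < s := hs
    have h1 : ∀ u : Fin d → ℝ, ENNReal.ofReal (s ^ (-(ν / 2)) *
        Real.exp (-(1 / 2) * ((σ + (u - u₀) ⬝ᵥ (W *ᵥ (u - u₀))) / s))) =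
        ENNReal.ofReal (s ^ (-(ν / 2)) * Real.exp (-(σ / 2 / s))) * ENNReal.ofReal
          (Real.exp (-(1 / 2) * ((u - u₀) ⬝ᵥ ((s⁻¹ • W) *ᵥ (u - u₀))))) := by
      intro u
      rw [← ENNReal.ofReal_mul (by positivity), mul_assoc, ← Real.exp_add, smul_mulVec,
        dotProduct_smul, smul_eq_mul]
      congr 3
      field_simp
      ring
    simp only [h1]
    rw [lintegral_const_mul' _ _ ENNReal.ofReal_ne_top,
      lintegral_gaussian (hW.smul (inv_pos.2 hs)), ← ENNReal.ofReal_mul (by positivity),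
      ← ENNReal.ofReal_mul (by have := hW.det_pos; positivity)]
    congr 1
    rw [det_smul, Fintype.card_fin, Real.mul_rpow (by positivity) hW.det_pos.le,
      ← Real.rpow_natCast, Real.inv_rpow hs.le, ← Real.rpow_neg hs.le, ← Real.rpow_mul hs.le,
      show -((ν - d - 2) / 2 + 1) = -(ν / 2) + -(d : ℝ) * (-1 / 2) by ring, Real.rpow_add hs]
    ring
  rw [setLIntegral_congr_fun measurableSet_Ioi hinner,
    lintegral_const_mul' _ _ ENNReal.ofReal_ne_top,
    lintegral_inverseGamma (by linarith) (by positivity), ← ENNReal.ofReal_mul]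
  have := hW.det_pos
  positivity

/-- Under the inverse Wishart law the lower right block separates from the other coordinates. -/
theorem lintegral_invWishartWeight_succ {W : Matrix (Fin d) (Fin d) ℝ} (hW : W.PosDef) {σ : ℝ}
    (hσ : 0 < σ) {ν : ℝ} (hν : (d : ℝ) + 2 < ν) (u₀ : Fin d → ℝ)
    {f : (Sym2 (Fin d) → ℝ) → ENNReal} (hf : Measurable f) :
    ∫⁻ y in posDefCone (d + 1), f (fun z => y (z.map Fin.succ)) *
      ENNReal.ofReal (invWishartWeight ν (bordered (σ + u₀ ⬝ᵥ (W *ᵥ u₀)) (W *ᵥ u₀) W)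
        (symMat y)) =
    (∫⁻ x in posDefCone d, f x * ENNReal.ofReal (invWishartWeight (ν - 2) W (symMat x))) *
      ENNReal.ofReal ((2 * Real.pi) ^ ((d : ℝ) / 2) * W.det ^ (-(1 : ℝ) / 2) *
        ((σ / 2) ^ (-((ν - d - 2) / 2)) * Real.Gamma ((ν - d - 2) / 2))) := by
  rw [lintegral_posDefCone_succ, ← lintegral_mul_const' _ _ ENNReal.ofReal_ne_top,
    ← lintegral_shear_kernel hW hσ hν u₀]
  swap
  · have := (measurable_invWishartWeight ν
      (bordered (σ + u₀ ⬝ᵥ (W *ᵥ u₀)) (W *ᵥ u₀) W)).ennreal_ofReal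
    exact (hf.comp (by fun_prop)).mul this
  refine setLIntegral_congr_fun (measurableSet_posDefCone d) fun x hx => ?_
  have hS : (symMat x).PosDef := hx
  have hdet := hS.det_pos
  have hq : Measurable fun u : Fin d → ℝ => (u - u₀) ⬝ᵥ (W *ᵥ (u - u₀)) := by
    refine Continuous.measurable ?_
    have h : Continuous fun u : Fin d → ℝ => u - u₀ := by fun_prop
    exact h.dotProduct (continuous_const.matrix_mulVec h)
  simp only [borderedCoord_map_succ, symMat_borderedCoord]
  have hinner : ∀ u : Fin d → ℝ, ∫⁻ s in Set.Ioi (0 : ℝ), f x * ENNReal.ofReal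
      (invWishartWeight ν (bordered (σ + u₀ ⬝ᵥ (W *ᵥ u₀)) (W *ᵥ u₀) W)
        (bordered (s + u ⬝ᵥ (symMat x *ᵥ u)) (symMat x *ᵥ u) (symMat x))) =
      (f x * ENNReal.ofReal ((symMat x).det ^ (-(ν / 2)) *
        Real.exp (-(1 / 2) * (W * (symMat x)⁻¹).trace))) *
      ∫⁻ s in Set.Ioi (0 : ℝ), ENNReal.ofReal (s ^ (-(ν / 2)) *
        Real.exp (-(1 / 2) * ((σ + (u - u₀) ⬝ᵥ (W *ᵥ (u - u₀))) / s))) := by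
    intro u
    rw [← lintegral_const_mul _ (by fun_prop)]
    refine setLIntegral_congr_fun measurableSet_Ioi fun s hs => ?_
    have hs : 0 < s := hs
    rw [mul_assoc, ← ENNReal.ofReal_mul (by positivity), invWishartWeight,
      trace_bordered_mul_inv hW hS hs, det_bordered (symMat_transpose x),
      Real.mul_rpow hs.le hdet.le, mul_add, Real.exp_add]
    congr 2
    ring
  simp only [hinner]
  rw [lintegral_const_mul, ← mul_assoc]
  swap
  · refine Measurable.lintegral_prod_right' (ν := volume.restrict (Set.Ioi (0 : ℝ)))
      (f := fun p : (Fin d → ℝ) × ℝ => ENNReal.ofReal (p.2 ^ (-(ν / 2)) *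
        Real.exp (-(1 / 2) * ((σ + (p.1 - u₀) ⬝ᵥ (W *ᵥ (p.1 - u₀))) / p.2)))) ?_
    have : Measurable fun p : (Fin d → ℝ) × ℝ => (p.1 - u₀) ⬝ᵥ (W *ᵥ (p.1 - u₀)) :=
      hq.comp measurable_fst
    fun_prop
  congr 1
  rw [mul_left_comm, ← ENNReal.ofReal_mul hdet.le, ← mul_assoc, invWishartWeight]
  congr 3
  -- The Jacobian `|S|` is absorbed into `|S|^{-ν/2}`; this is the shift from `ν` to `ν - 2`.
  rw [show -((ν - 2) / 2) = 1 + -(ν / 2) by ring, Real.rpow_add hdet, Real.rpow_one]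

end Weight

/-! ### Normalizing constant and mean of the last diagonal entry. -/

section Normalization

theorem multiGamma_pos {d : ℕ} {a : ℝ} (ha : (d : ℝ) - 1 < 2 * a) : 0 < multiGamma d a := by
  unfold multiGamma
  refine mul_pos (Real.rpow_pos_of_pos Real.pi_pos _)
    (Finset.prod_pos fun i _ => Real.Gamma_pos_of_pos ?_)
  have : ((i : ℕ) : ℝ) + 1 ≤ d := by exact_mod_cast i.2
  linarith

theorem multiGamma_succ (d : ℕ) (a : ℝ) :
    multiGamma (d + 1) a =
      Real.pi ^ ((d : ℝ) / 2) * Real.Gamma a * multiGamma d (a - 1 / 2) := by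
  unfold multiGamma
  rw [Fin.prod_univ_succ]
  have h1 : ∀ i : Fin d, a - ((i.succ : Fin (d + 1)) : ℕ) / 2 = a - 1 / 2 - ((i : ℕ) : ℝ) / 2 := by
    intro i
    push_cast [Fin.val_succ]
    ring
  simp only [h1]
  rw [show ((d + 1 : ℕ) : ℝ) * (((d + 1 : ℕ) : ℝ) - 1) / 4 =
    (d : ℝ) / 2 + (d : ℝ) * ((d : ℝ) - 1) / 4 by push_cast; ring, Real.rpow_add Real.pi_pos]
  simp
  ring

/-- The normalizing constant of the inverse Wishart density. -/
def invWishartConst (d : ℕ) (ν D : ℝ) : ℝ :=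
  2 ^ ((d : ℝ) * (ν - d - 1) / 2) * multiGamma d ((ν - d - 1) / 2) * D ^ (-((ν - d - 1) / 2))

theorem invWishartConst_pos {d : ℕ} {ν D : ℝ} (hν : 2 * (d : ℝ) < ν) (hD : 0 < D) :
    0 < invWishartConst d ν D := by
  have := multiGamma_pos (d := d) (a := (ν - d - 1) / 2) (by linarith)
  unfold invWishartConst
  positivity

/-- The factor on the right is the value of the integral over `(s, u)`, so the constant satisfies
the same recursion as the total mass. -/
theorem invWishartConst_succ {d : ℕ} {ν σ D : ℝ} (hσ : 0 < σ) (hD : 0 < D) :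
    invWishartConst (d + 1) ν (σ * D) = invWishartConst d (ν - 2) D *
      ((2 * Real.pi) ^ ((d : ℝ) / 2) * D ^ (-(1 : ℝ) / 2) *
        ((σ / 2) ^ (-((ν - d - 2) / 2)) * Real.Gamma ((ν - d - 2) / 2))) := by
  unfold invWishartConst
  rw [multiGamma_succ]
  have e1 : (ν - ((d + 1 : ℕ) : ℝ) - 1) / 2 = (ν - d - 2) / 2 := by push_cast; ring
  have e2 : (ν - d - 2) / 2 - 1 / 2 = (ν - 2 - d - 1) / 2 := by ring
  have e3 : ((d + 1 : ℕ) : ℝ) * (ν - ((d + 1 : ℕ) : ℝ) - 1) / 2 =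
      (d : ℝ) * (ν - 2 - d - 1) / 2 + (d : ℝ) / 2 + (ν - d - 2) / 2 := by push_cast; ring
  have e4 : -((ν - d - 2) / 2) = -((ν - 2 - d - 1) / 2) + -(1 : ℝ) / 2 := by ring
  rw [e1, e2, e3, Real.mul_rpow hσ.le hD.le, Real.rpow_add two_pos, Real.rpow_add two_pos,
    Real.mul_rpow two_pos.le Real.pi_pos.le, Real.div_rpow hσ.le two_pos.le,
    Real.rpow_neg two_pos.le ((ν - d - 2) / 2)]
  have e5 : D ^ (-((ν - d - 2) / 2)) = D ^ (-((ν - 2 - d - 1) / 2)) * D ^ (-(1 : ℝ) / 2) := by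
    rw [← Real.rpow_add hD, e4]
  rw [e5]
  have : (2 : ℝ) ^ ((ν - d - 2) / 2) ≠ 0 := by positivity
  field_simp

theorem lintegral_invWishartWeight (d : ℕ) : ∀ {ν : ℝ} {V : Matrix (Fin d) (Fin d) ℝ},
    2 * (d : ℝ) < ν → V.PosDef →
    ∫⁻ x in posDefCone d, ENNReal.ofReal (invWishartWeight ν V (symMat x)) =
      ENNReal.ofReal (invWishartConst d ν V.det) := by
  induction d with
  | zero =>
    intro ν V hν hV
    have hc : posDefCone 0 = Set.univ := by
      refine Set.eq_univ_of_forall fun x => ?_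
      change (symMat x).PosDef
      rw [Subsingleton.elim (symMat x) 1]
      exact PosDef.one
    simp [hc, invWishartWeight, invWishartConst, multiGamma, volume_pi, trace]
  | succ d ih =>
    intro ν V hν hV
    push_cast at hν
    obtain ⟨σ, u₀, W, hσ, hW, rfl⟩ := exists_bordered_of_posDef hV
    have hd : (0 : ℝ) ≤ d := d.cast_nonneg
    have h := lintegral_invWishartWeight_succ hW hσ (ν := ν) (by linarith) u₀
      (f := fun _ => 1) measurable_const
    simp only [one_mul] at h
    rw [h, ih (by linarith) hW, ← ENNReal.ofReal_mul
      (invWishartConst_pos (by linarith) hW.det_pos).le,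
      ← invWishartConst_succ hσ hW.det_pos, det_bordered (by simpa using hW.isHermitian.eq)]

/-- The last entry survives every passage to the lower right block, which makes the induction close.
The denominator is stable under it, since lowering `d` by one and `ν` by two preserves `ν - 2d - 2`.
-/
theorem lintegral_last_mul_invWishartWeight (d : ℕ) :
    ∀ {ν : ℝ} {V : Matrix (Fin (d + 1)) (Fin (d + 1)) ℝ},
    2 * ((d : ℝ) + 1) + 2 < ν → V.PosDef →
    ∫⁻ x in posDefCone (d + 1), ENNReal.ofReal (symMat x (Fin.last d) (Fin.last d)) *
        ENNReal.ofReal (invWishartWeight ν V (symMat x)) =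
      ENNReal.ofReal (V (Fin.last d) (Fin.last d) / (ν - 2 * ((d : ℝ) + 1) - 2) *
        invWishartConst (d + 1) ν V.det) := by
  induction d with
  | zero =>
    intro ν V hν hV
    simp only [CharP.cast_eq_zero, zero_add, mul_one] at hν
    -- In dimension one, multiplying by `x` lowers `ν` by two, so the mean is a ratio of two
    -- normalizing constants; `Γ(a + 1) = aΓ(a)` evaluates it.
    have hVdet : V.det = V 0 0 := by simp
    have hpos : 0 < V 0 0 := hV.diag_pos
    have hV2 : ∫⁻ x in posDefCone 1, ENNReal.ofReal (symMat x 0 0) *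
        ENNReal.ofReal (invWishartWeight ν V (symMat x)) =
        ∫⁻ x in posDefCone 1, ENNReal.ofReal (invWishartWeight (ν - 2) V (symMat x)) := by
      refine setLIntegral_congr_fun (measurableSet_posDefCone 1) fun x hx => ?_
      have hx : (symMat x).PosDef := hx
      have hx0 : 0 < symMat x 0 0 := hx.diag_pos
      have hdet : (symMat x).det = symMat x 0 0 := by simp
      rw [← ENNReal.ofReal_mul hx0.le, invWishartWeight, invWishartWeight, hdet, ← mul_assoc]
      congr 2
      rw [show -((ν - 2) / 2) = 1 + -(ν / 2) by ring, Real.rpow_add hx0, Real.rpow_one]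
    have e : (Fin.last 0) = 0 := rfl
    simp only [zero_add, e]
    rw [hV2, lintegral_invWishartWeight 1 (by norm_num; linarith) hV]
    congr 1
    rw [hVdet]
    simp only [invWishartConst, multiGamma]
    norm_num
    have h1 : (ν - 1 - 1) / 2 = (ν - 2 - 1 - 1) / 2 + 1 := by ring
    rw [h1, Real.Gamma_add_one (by linarith), neg_add, Real.rpow_add hpos, Real.rpow_neg_one,
      Real.rpow_add two_pos, Real.rpow_one]
    have : ν - 2 - 2 ≠ 0 := by linarith
    have : ν - 2 - 1 - 1 ≠ 0 := by linarith
    field_simp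
    ring
  | succ d ih =>
    intro ν V hν hV
    push_cast at hν
    obtain ⟨σ, u₀, W, hσ, hW, rfl⟩ := exists_bordered_of_posDef hV
    have hd : (0 : ℝ) ≤ d := d.cast_nonneg
    have h := lintegral_invWishartWeight_succ hW hσ (ν := ν) (by push_cast; linarith) u₀
      (f := fun x => ENNReal.ofReal (symMat x (Fin.last d) (Fin.last d)))
      (measurable_symMat_apply _ _).ennreal_ofReal
    have hlast : ∀ y : Sym2 (Fin (d + 1 + 1)) → ℝ,
        symMat (fun z => y (z.map Fin.succ)) (Fin.last d) (Fin.last d) =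
          symMat y (Fin.last (d + 1)) (Fin.last (d + 1)) := fun y => rfl
    simp only [hlast] at h
    have hWl : 0 < W (Fin.last d) (Fin.last d) := hW.diag_pos
    have hκ : 0 < ν - 2 - 2 * ((d : ℝ) + 1) - 2 := by linarith
    have hc := invWishartConst_pos (d := d + 1) (ν := ν - 2) (by push_cast; linarith) hW.det_pos
    rw [h, ih (by linarith) hW, ← ENNReal.ofReal_mul (by positivity), mul_assoc,
      ← invWishartConst_succ hσ hW.det_pos, det_bordered (by simpa using hW.isHermitian.eq),
      ← Fin.succ_last, bordered_succ_succ]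
    congr 3
    push_cast
    ring

end Normalization

/-! ### Equivariance under congruence. -/

section Congruence

variable {d : ℕ}

/-- The action `X ↦ A X Aᵀ` in the coordinates of symmetric matrices. -/
def congrCoord (A : Matrix (Fin d) (Fin d) ℝ) :
    (Sym2 (Fin d) → ℝ) →ₗ[ℝ] (Sym2 (Fin d) → ℝ) where
  -- Averaging the `(i, j)` and `(j, i)` entries makes the map well defined on unordered pairs by
  -- construction; the two entries in fact agree.
  toFun x z := Sym2.lift ⟨fun i j =>
    ((A * symMat x * Aᵀ) i j + (A * symMat x * Aᵀ) j i) / 2, fun _ _ => congrArg (· / 2) (add_comm _ _)⟩ z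
  map_add' x y := by
    funext z
    induction z using Sym2.ind with
    | _ i j =>
      have h : symMat (x + y) = symMat x + symMat y := rfl
      simp only [Sym2.lift_mk, Pi.add_apply, h, Matrix.mul_add, Matrix.add_mul, Matrix.add_apply]
      ring
  map_smul' c x := by
    funext z
    induction z using Sym2.ind with
    | _ i j =>
      have h : symMat (c • x) = c • symMat x := rfl
      simp only [Sym2.lift_mk, Pi.smul_apply, h, Matrix.mul_smul, Matrix.smul_mul,
        Matrix.smul_apply, RingHom.id_apply, smul_eq_mul]
      ring

theorem symMat_congrCoord (A : Matrix (Fin d) (Fin d) ℝ) (x : Sym2 (Fin d) → ℝ) :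
    symMat (congrCoord A x) = A * symMat x * Aᵀ := by
  have hs : (A * symMat x * Aᵀ)ᵀ = A * symMat x * Aᵀ := by
    simp [transpose_mul, symMat_transpose, Matrix.mul_assoc]
  ext i j
  change ((A * symMat x * Aᵀ) i j + (A * symMat x * Aᵀ)ᵀ i j) / 2 = _
  rw [hs]
  ring

theorem det_congrCoord_ne_zero {A : Matrix (Fin d) (Fin d) ℝ} (hA : A.det ≠ 0) :
    LinearMap.det (congrCoord A) ≠ 0 := by
  have hA' := isUnit_iff_ne_zero.2 hA
  have h : congrCoord A * congrCoord A⁻¹ = 1 := by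
    refine LinearMap.ext fun x => ?_
    apply symMat_injective
    rw [Module.End.mul_apply, symMat_congrCoord, symMat_congrCoord, Module.End.one_apply,
      Matrix.mul_assoc, Matrix.mul_assoc, ← transpose_mul, Matrix.mul_nonsing_inv _ hA',
      transpose_one, Matrix.mul_one, ← Matrix.mul_assoc, Matrix.mul_nonsing_inv _ hA',
      Matrix.one_mul]
  intro h0
  have := congrArg LinearMap.det h
  rw [map_mul, h0, zero_mul, map_one] at this
  exact zero_ne_one this

theorem posDef_mul_mul_transpose_iff {A X : Matrix (Fin d) (Fin d) ℝ} (hA : A.det ≠ 0) :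
    (A * X * Aᵀ).PosDef ↔ X.PosDef := by
  have h : IsUnit A := (isUnit_iff_isUnit_det _).2 (isUnit_iff_ne_zero.2 hA)
  rw [← h.posDef_star_right_conjugate_iff (x := X), star_eq_conjTranspose,
    conjTranspose_eq_transpose_of_trivial]

theorem invWishartWeight_congr {A V X : Matrix (Fin d) (Fin d) ℝ} (hA : A.det ≠ 0)
    (hX : X.PosDef) (ν : ℝ) :
    invWishartWeight ν (A * V * Aᵀ) (A * X * Aᵀ) =
      (A.det ^ 2) ^ (-(ν / 2)) * invWishartWeight ν V X := by
  have hA' := isUnit_iff_ne_zero.2 hA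
  have ht : (A * V * Aᵀ * (A * X * Aᵀ)⁻¹).trace = (V * X⁻¹).trace := by
    have h1 : Aᵀ * Aᵀ⁻¹ = 1 := Matrix.mul_nonsing_inv _ (by rwa [det_transpose])
    have h2 : A⁻¹ * A = 1 := Matrix.nonsing_inv_mul _ hA'
    rw [Matrix.mul_inv_rev, Matrix.mul_inv_rev,
      show A * V * Aᵀ * (Aᵀ⁻¹ * (X⁻¹ * A⁻¹)) = A * V * (Aᵀ * Aᵀ⁻¹) * X⁻¹ * A⁻¹ by
        simp only [Matrix.mul_assoc],
      h1, Matrix.mul_one, trace_mul_comm, ← Matrix.mul_assoc, ← Matrix.mul_assoc, h2,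
      Matrix.one_mul]
  have hd : (A * X * Aᵀ).det = A.det ^ 2 * X.det := by
    rw [det_mul, det_mul, det_transpose]
    ring
  rw [invWishartWeight, invWishartWeight, ht, hd, Real.mul_rpow (sq_nonneg _) hX.det_pos.le]
  ring

/-- If `X` has law `IW(ν, V)` then `A X Aᵀ` has law `IW(ν, A V Aᵀ)`. -/
theorem lintegral_congrCoord {A V : Matrix (Fin d) (Fin d) ℝ} (hA : A.det ≠ 0) (hV : V.PosDef)
    {ν : ℝ} (hν : 2 * (d : ℝ) < ν) {f : (Sym2 (Fin d) → ℝ) → ENNReal} (hf : Measurable f) :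
    (∫⁻ x in posDefCone d, f (congrCoord A x) * ENNReal.ofReal (invWishartWeight ν V (symMat x))) *
        ENNReal.ofReal (invWishartConst d ν (A * V * Aᵀ).det) =
      (∫⁻ x in posDefCone d, f x * ENNReal.ofReal (invWishartWeight ν (A * V * Aᵀ) (symMat x))) *
        ENNReal.ofReal (invWishartConst d ν V.det) := by
  have hAV : (A * V * Aᵀ).PosDef := (posDef_mul_mul_transpose_iff hA).2 hV
  have hL := det_congrCoord_ne_zero hA
  have hLm : Measurable (congrCoord A) :=
    (LinearMap.continuous_of_finiteDimensional _).measurable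
  set k := ENNReal.ofReal ((A.det ^ 2) ^ (-(ν / 2))) with hk
  set c := ENNReal.ofReal |(LinearMap.det (congrCoord A))⁻¹| with hc
  have hk0 : k ≠ 0 := by
    rw [hk, Ne, ENNReal.ofReal_eq_zero, not_le]
    positivity
  have hc0 : c ≠ 0 := by
    rw [hc, Ne, ENNReal.ofReal_eq_zero, not_le]
    positivity
  have key : ∀ {g : (Sym2 (Fin d) → ℝ) → ENNReal}, Measurable g →
      k * (∫⁻ x in posDefCone d, g (congrCoord A x) *
        ENNReal.ofReal (invWishartWeight ν V (symMat x))) =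
      c * ∫⁻ x in posDefCone d, g x *
        ENNReal.ofReal (invWishartWeight ν (A * V * Aᵀ) (symMat x)) := by
    intro g hg
    have hw := (measurable_invWishartWeight ν (A * V * Aᵀ)).ennreal_ofReal
    have h := lintegral_map (μ := volume)
      ((hg.mul hw).indicator (measurableSet_posDefCone d)) hLm
    rw [Real.map_linearMap_volume_pi_eq_smul_volume_pi hL, lintegral_smul_measure,
      lintegral_indicator (measurableSet_posDefCone d), smul_eq_mul] at h
    simp only [Pi.mul_apply] at h
    rw [h, ← lintegral_const_mul' _ _ ENNReal.ofReal_ne_top,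
      ← lintegral_indicator (measurableSet_posDefCone d)]
    refine lintegral_congr fun x => ?_
    have hiff : congrCoord A x ∈ posDefCone d ↔ x ∈ posDefCone d := by
      change (symMat _).PosDef ↔ (symMat x).PosDef
      rw [symMat_congrCoord, posDef_mul_mul_transpose_iff hA]
    by_cases hx : x ∈ posDefCone d
    · rw [Set.indicator_of_mem hx, Set.indicator_of_mem (hiff.2 hx), Pi.mul_apply,
        symMat_congrCoord, invWishartWeight_congr hA hx, ENNReal.ofReal_mul (by positivity)]
      ring
    · rw [Set.indicator_of_notMem hx, Set.indicator_of_notMem (fun h => hx (hiff.1 h))]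
  -- The Jacobian of `X ↦ AXAᵀ` is never computed: the total masses are known on both sides, so the
  -- case of a constant function determines `c / k`.
  have h1 := key (g := fun _ => 1) measurable_const
  simp only [one_mul] at h1
  rw [lintegral_invWishartWeight d hν hV, lintegral_invWishartWeight d hν hAV] at h1
  have h2 := key hf
  refine (ENNReal.mul_right_inj (mul_ne_zero hk0 hc0)
    (ENNReal.mul_ne_top ENNReal.ofReal_ne_top ENNReal.ofReal_ne_top)).1 ?_
  calc k * c * (_ * _) = (k * _) * (c * _) := mul_mul_mul_comm _ _ _ _
    _ = _ := by rw [h2, ← h1]; ring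

end Congruence

/-! ### The mean of the inverse Wishart law. -/

section Mean

variable {d : ℕ}

/-- Invertible maps act transitively on nonzero vectors; the transpose turns the image of the last
basis vector, a column, into a row. -/
theorem exists_det_ne_zero_row_eq {c : Fin (d + 1) → ℝ} (hc : c ≠ 0) :
    ∃ A : Matrix (Fin (d + 1)) (Fin (d + 1)) ℝ, A.det ≠ 0 ∧ A (Fin.last d) = c := by
  have h1 : (Pi.single (Fin.last d) 1 : Fin (d + 1) → ℝ) ≠ 0 := by
    intro h
    simpa using congrFun h (Fin.last d)
  obtain ⟨e, he⟩ := SeparatingDual.exists_continuousLinearEquiv_apply_eq (R := ℝ) h1 hc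
  refine ⟨(LinearMap.toMatrix' (e.toLinearEquiv : (Fin (d + 1) → ℝ) →ₗ[ℝ] (Fin (d + 1) → ℝ)))ᵀ,
    ?_, ?_⟩
  · rw [det_transpose, LinearMap.det_toMatrix']
    exact (LinearEquiv.isUnit_det' e.toLinearEquiv).ne_zero
  · funext i
    rw [transpose_apply, LinearMap.toMatrix'_apply]
    rw [← he]
    congr 2

theorem mul_mul_transpose_apply_self (A X : Matrix (Fin d) (Fin d) ℝ) (i : Fin d) :
    (A * X * Aᵀ) i i = A i ⬝ᵥ (X *ᵥ A i) := by
  rw [Matrix.mul_assoc, mul_apply_eq_vecMul, ← mul_apply_eq_vecMul]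
  simp only [mul_apply, dotProduct, mulVec, transpose_apply]

/-- If `A` has last row `c`, then `cᵀXc` is the last diagonal entry of `AXAᵀ`, so equivariance
reduces to that entry. -/
theorem lintegral_quadForm_invWishartWeight {V : Matrix (Fin d) (Fin d) ℝ} (hV : V.PosDef) {ν : ℝ}
    (hν : 2 * (d : ℝ) + 2 < ν) {c : Fin d → ℝ} (hc : c ≠ 0) :
    ∫⁻ x in posDefCone d, ENNReal.ofReal (c ⬝ᵥ (symMat x *ᵥ c)) *
        ENNReal.ofReal (invWishartWeight ν V (symMat x)) =
      ENNReal.ofReal (c ⬝ᵥ (V *ᵥ c) / (ν - 2 * d - 2) * invWishartConst d ν V.det) := by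
  cases d with
  | zero => exact absurd (Subsingleton.elim _ _) hc
  | succ d =>
    obtain ⟨A, hA, rfl⟩ := exists_det_ne_zero_row_eq hc
    have hAV : (A * V * Aᵀ).PosDef := (posDef_mul_mul_transpose_iff hA).2 hV
    have h := lintegral_congrCoord hA hV (ν := ν) (by linarith)
      (measurable_symMat_apply (Fin.last d) (Fin.last d)).ennreal_ofReal
    simp only [symMat_congrCoord, mul_mul_transpose_apply_self] at h
    push_cast at hν
    rw [lintegral_last_mul_invWishartWeight d hν hAV, mul_mul_transpose_apply_self] at h
    have hq := hAV.diag_pos (i := Fin.last d)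
    rw [mul_mul_transpose_apply_self] at hq
    have hκ : 0 < ν - 2 * ((d : ℝ) + 1) - 2 := by linarith
    have c1 := invWishartConst_pos (d := d + 1) (ν := ν) (by push_cast; linarith) hAV.det_pos
    have c2 := invWishartConst_pos (d := d + 1) (ν := ν) (by push_cast; linarith) hV.det_pos
    refine (ENNReal.mul_left_inj (c := ENNReal.ofReal
      (invWishartConst (d + 1) ν (A * V * Aᵀ).det)) ?_ ENNReal.ofReal_ne_top).1 ?_
    · rwa [Ne, ENNReal.ofReal_eq_zero, not_le]
    · rw [h, ← ENNReal.ofReal_mul (by positivity), ← ENNReal.ofReal_mul (by push_cast; positivity)]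
      push_cast
      congr 1
      ring

theorem invWishartPdf_eq {V X : Matrix (Fin d) (Fin d) ℝ} (hV : V.PosDef) (hX : X.PosDef) (ν : ℝ) :
    invWishartPdf ν V X = invWishartWeight ν V X / invWishartConst d ν V.det := by
  rw [invWishartPdf, invWishartWeight, invWishartConst, Real.rpow_neg hX.det_pos.le,
    Real.rpow_neg hV.det_pos.le]
  have := Real.rpow_pos_of_pos hX.det_pos (ν / 2)
  have := Real.rpow_pos_of_pos hV.det_pos ((ν - d - 1) / 2)
  field_simp

theorem hasIntegral_quadForm_invWishart {V : Matrix (Fin d) (Fin d) ℝ} (hV : V.PosDef) {ν : ℝ}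
    (hν : 2 * (d : ℝ) + 2 < ν) (c : Fin d → ℝ) :
    IntegrableOn (fun x => (c ⬝ᵥ (symMat x *ᵥ c)) * invWishartPdf ν V (symMat x)) (posDefCone d) ∧
    ∫ x in posDefCone d, (c ⬝ᵥ (symMat x *ᵥ c)) * invWishartPdf ν V (symMat x) =
      c ⬝ᵥ (V *ᵥ c) / (ν - 2 * d - 2) := by
  by_cases hc : c = 0
  · simp [hc]
  have hC := invWishartConst_pos (d := d) (ν := ν) (by linarith) hV.det_pos
  have hcV : 0 < c ⬝ᵥ (V *ᵥ c) := by simpa using hV.dotProduct_mulVec_pos hc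
  have hκ : 0 < ν - 2 * d - 2 := by linarith
  set g : (Sym2 (Fin d) → ℝ) → ℝ := fun x =>
    (c ⬝ᵥ (symMat x *ᵥ c)) * (invWishartWeight ν V (symMat x) / invWishartConst d ν V.det)
  have hgm : Measurable g := by
    have h1 : Continuous fun x : Sym2 (Fin d) → ℝ => c ⬝ᵥ (symMat x *ᵥ c) :=
      continuous_const.dotProduct (continuous_symMat.matrix_mulVec continuous_const)
    exact h1.measurable.mul ((measurable_invWishartWeight ν V).div_const _)
  have hpos : ∀ x ∈ posDefCone d, 0 < c ⬝ᵥ (symMat x *ᵥ c) := fun x hx => by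
    have hx : (symMat x).PosDef := hx
    simpa using hx.dotProduct_mulVec_pos hc
  have hg0 : 0 ≤ᵐ[volume.restrict (posDefCone d)] g := by
    filter_upwards [ae_restrict_mem (measurableSet_posDefCone d)] with x hx
    exact mul_nonneg (hpos x hx).le (div_nonneg (invWishartWeight_pos ν V hx).le hC.le)
  have hl : ∫⁻ x in posDefCone d, ENNReal.ofReal (g x) =
      ENNReal.ofReal (c ⬝ᵥ (V *ᵥ c) / (ν - 2 * d - 2)) := by
    have h1 : ∀ x ∈ posDefCone d, ENNReal.ofReal (g x) =
        (ENNReal.ofReal (c ⬝ᵥ (symMat x *ᵥ c)) *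
        ENNReal.ofReal (invWishartWeight ν V (symMat x))) *
          ENNReal.ofReal (invWishartConst d ν V.det)⁻¹ := fun x hx => by
      rw [← ENNReal.ofReal_mul (hpos x hx).le, ← ENNReal.ofReal_mul
        (mul_nonneg (hpos x hx).le (invWishartWeight_pos ν V hx).le), mul_assoc, ← div_eq_mul_inv]
    rw [setLIntegral_congr_fun (measurableSet_posDefCone d) h1,
      lintegral_mul_const' _ _ ENNReal.ofReal_ne_top,
      lintegral_quadForm_invWishartWeight hV hν hc, ← ENNReal.ofReal_mul (by positivity), mul_assoc,
      mul_inv_cancel₀ hC.ne', mul_one]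
  have hcongr : Set.EqOn (fun x => (c ⬝ᵥ (symMat x *ᵥ c)) * invWishartPdf ν V (symMat x)) g
      (posDefCone d) := fun x hx => by
    simp only [g, invWishartPdf_eq hV hx]
  constructor
  · refine (integrableOn_congr_fun hcongr (measurableSet_posDefCone d)).2
      ⟨hgm.aestronglyMeasurable, ?_⟩
    rw [hasFiniteIntegral_iff_ofReal hg0, hl]
    exact ENNReal.ofReal_lt_top
  · rw [setIntegral_congr_fun (measurableSet_posDefCone d) hcongr,
      integral_eq_lintegral_of_nonneg_ae hg0 hgm.aestronglyMeasurable, hl,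
      ENNReal.toReal_ofReal (by positivity)]

/-- Polarization, used to pass from quadratic forms to entries. -/
theorem apply_eq_quadForm {X : Matrix (Fin d) (Fin d) ℝ} (hX : Xᵀ = X) (i j : Fin d) :
    X i j = 2⁻¹ * ((Pi.single i 1 + Pi.single j 1) ⬝ᵥ (X *ᵥ (Pi.single i 1 + Pi.single j 1)) -
      Pi.single i 1 ⬝ᵥ (X *ᵥ Pi.single i 1) - Pi.single j 1 ⬝ᵥ (X *ᵥ Pi.single j 1)) := by
  have h : X j i = X i j := congrFun (congrFun hX i) j
  simp [mulVec_add, add_dotProduct, dotProduct_add, h]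
  ring

theorem hasIntegral_apply_invWishart {V : Matrix (Fin d) (Fin d) ℝ} (hV : V.PosDef) {ν : ℝ}
    (hν : 2 * (d : ℝ) + 2 < ν) (i j : Fin d) :
    IntegrableOn (fun x => symMat x i j * invWishartPdf ν V (symMat x)) (posDefCone d) ∧
    ∫ x in posDefCone d, symMat x i j * invWishartPdf ν V (symMat x) =
      V i j / (ν - 2 * d - 2) := by
  obtain ⟨i1, e1⟩ := hasIntegral_quadForm_invWishart hV hν (Pi.single i 1 + Pi.single j 1)
  obtain ⟨i2, e2⟩ := hasIntegral_quadForm_invWishart hV hν (Pi.single i 1)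
  obtain ⟨i3, e3⟩ := hasIntegral_quadForm_invWishart hV hν (Pi.single j 1)
  have hfun : (fun x => symMat x i j * invWishartPdf ν V (symMat x)) = fun x =>
      2⁻¹ * ((Pi.single i 1 + Pi.single j 1) ⬝ᵥ (symMat x *ᵥ (Pi.single i 1 + Pi.single j 1)) *
        invWishartPdf ν V (symMat x) -
      Pi.single i 1 ⬝ᵥ (symMat x *ᵥ Pi.single i 1) * invWishartPdf ν V (symMat x) -
      Pi.single j 1 ⬝ᵥ (symMat x *ᵥ Pi.single j 1) * invWishartPdf ν V (symMat x)) := by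
    funext x
    rw [apply_eq_quadForm (symMat_transpose x) i j]
    ring
  rw [hfun]
  refine ⟨((i1.sub i2).sub i3).const_mul _, ?_⟩
  have h1 := integral_sub (i1.sub i2) i3
  simp only [Pi.sub_apply] at h1
  rw [integral_const_mul, h1, integral_sub i1 i2, e1, e2, e3,
    apply_eq_quadForm (by simpa using hV.isHermitian.eq : Vᵀ = V) i j]
  ring

theorem invWishartMeanExists {V : Matrix (Fin d) (Fin d) ℝ} (hV : V.PosDef) {ν : ℝ}
    (hν : 2 * (d : ℝ) + 2 < ν) : InvWishartMeanExists ν V :=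
  fun i j => (hasIntegral_apply_invWishart hV hν i j).1

/-- The mean of the inverse Wishart law `IW_d(ν, V)` is `V / (ν - 2d - 2)`. -/
theorem invWishartMean_eq {V : Matrix (Fin d) (Fin d) ℝ} (hV : V.PosDef) {ν : ℝ}
    (hν : 2 * (d : ℝ) + 2 < ν) : invWishartMean ν V = (ν - 2 * d - 2)⁻¹ • V := by
  ext i j
  rw [invWishartMean, of_apply, (hasIntegral_apply_invWishart hV hν i j).2, Matrix.smul_apply,
    smul_eq_mul]
  ring

end Mean

/-! ### Matrix integrals against the Gaussian density. -/

section Gaussian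

variable {n d : ℕ} {m : Fin n → ℝ} {P : Matrix (Fin n) (Fin n) ℝ}

theorem gaussianPdf_pos (m : Fin n → ℝ) (hP : P.PosDef) (x : Fin n → ℝ) :
    0 < gaussianPdf m P x := by
  have := hP.det_pos
  unfold gaussianPdf
  positivity

theorem measurable_gaussianPdf (m : Fin n → ℝ) (P : Matrix (Fin n) (Fin n) ℝ) :
    Measurable (gaussianPdf m P) := by
  have h : Continuous fun x : Fin n → ℝ => x - m := by fun_prop
  have hq : Measurable fun x : Fin n → ℝ => (x - m) ⬝ᵥ (P⁻¹ *ᵥ (x - m)) :=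
    (h.dotProduct (continuous_const.matrix_mulVec h)).measurable
  unfold gaussianPdf
  fun_prop

theorem lintegral_gaussianPdf (m : Fin n → ℝ) (hP : P.PosDef) :
    ∫⁻ x, ENNReal.ofReal (gaussianPdf m P x) = 1 := by
  have hdet := hP.det_pos
  have hc : (0 : ℝ) < (2 * Real.pi) ^ ((n : ℝ) / 2) * P.det ^ ((1 : ℝ) / 2) := by positivity
  have h : ∀ x, ENNReal.ofReal (gaussianPdf m P x) =
      ENNReal.ofReal (Real.exp (-(1 / 2) * ((x - m) ⬝ᵥ (P⁻¹ *ᵥ (x - m))))) *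
        ENNReal.ofReal ((2 * Real.pi) ^ ((n : ℝ) / 2) * P.det ^ ((1 : ℝ) / 2))⁻¹ := fun x => by
    rw [← ENNReal.ofReal_mul (Real.exp_pos _).le, ← div_eq_mul_inv]
    rfl
  simp only [h]
  rw [lintegral_mul_const' _ _ ENNReal.ofReal_ne_top, lintegral_gaussian hP.inv,
    det_nonsing_inv, Ring.inverse_eq_inv', neg_div, Real.rpow_neg (inv_pos.2 hdet).le,
    Real.inv_rpow hdet.le, inv_inv, ← ENNReal.ofReal_mul hc.le, mul_inv_cancel₀ hc.ne',
    ENNReal.ofReal_one]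

theorem integrable_gaussianPdf (m : Fin n → ℝ) (hP : P.PosDef) : Integrable (gaussianPdf m P) := by
  refine ⟨(measurable_gaussianPdf m P).aestronglyMeasurable, ?_⟩
  rw [hasFiniteIntegral_iff_ofReal (ae_of_all _ fun x => (gaussianPdf_pos m hP x).le),
    lintegral_gaussianPdf m hP]
  exact ENNReal.one_lt_top

theorem integral_gaussianPdf (m : Fin n → ℝ) (hP : P.PosDef) : ∫ x, gaussianPdf m P x = 1 := by
  rw [integral_eq_lintegral_of_nonneg_ae (ae_of_all _ fun x => (gaussianPdf_pos m hP x).le)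
    (measurable_gaussianPdf m P).aestronglyMeasurable, lintegral_gaussianPdf m hP,
    ENNReal.toReal_one]

/-- The factor `t` is the density under the integral sign and `1` outside it. -/
theorem bilin_mul_eq_sum (X : Matrix (Fin d) (Fin d) ℝ) (a b : Fin d → ℝ) (t : ℝ) :
    (a ⬝ᵥ (X *ᵥ b)) * t = ∑ i, ∑ j, a i * b j * (X i j * t) := by
  simp only [dotProduct, mulVec, Finset.mul_sum, Finset.sum_mul]
  exact Finset.sum_congr rfl fun _ _ => Finset.sum_congr rfl fun _ _ => by ring

theorem GaussianIntegrable.bilin {F : (Fin n → ℝ) → Matrix (Fin d) (Fin d) ℝ}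
    (hF : GaussianIntegrable m P F) (a b : Fin d → ℝ) :
    Integrable fun x => (a ⬝ᵥ (F x *ᵥ b)) * gaussianPdf m P x := by
  simp only [bilin_mul_eq_sum]
  exact integrable_finsetSum _ fun i _ => integrable_finsetSum _ fun j _ => (hF i j).const_mul _

theorem GaussianIntegrable.integral_bilin {F : (Fin n → ℝ) → Matrix (Fin d) (Fin d) ℝ}
    (hF : GaussianIntegrable m P F) (a b : Fin d → ℝ) :
    ∫ x, (a ⬝ᵥ (F x *ᵥ b)) * gaussianPdf m P x = a ⬝ᵥ (gaussianIntegral m P F *ᵥ b) := by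
  simp only [bilin_mul_eq_sum]
  rw [integral_finsetSum _ fun i _ => integrable_finsetSum _ fun j _ => (hF i j).const_mul _,
    ← mul_one (a ⬝ᵥ _), bilin_mul_eq_sum]
  refine Finset.sum_congr rfl fun i _ => ?_
  rw [integral_finsetSum _ fun j _ => (hF i j).const_mul _]
  refine Finset.sum_congr rfl fun j _ => ?_
  rw [integral_const_mul, mul_one]
  rfl

theorem GaussianIntegrable.smul {F : (Fin n → ℝ) → Matrix (Fin d) (Fin d) ℝ}
    (hF : GaussianIntegrable m P F) (c : ℝ) : GaussianIntegrable m P fun x => c • F x := by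
  intro i j
  simp only [Matrix.smul_apply, smul_eq_mul, mul_assoc]
  exact (hF i j).const_mul c

theorem gaussianIntegral_smul (F : (Fin n → ℝ) → Matrix (Fin d) (Fin d) ℝ) (c : ℝ) :
    gaussianIntegral m P (fun x => c • F x) = c • gaussianIntegral m P F := by
  ext i j
  simp only [gaussianIntegral, of_apply, Matrix.smul_apply, smul_eq_mul, mul_assoc]
  rw [integral_const_mul]

theorem GaussianIntegrable.posDef {F : (Fin n → ℝ) → Matrix (Fin d) (Fin d) ℝ}
    (hF : GaussianIntegrable m P F) (hP : P.PosDef) (hpos : ∀ x, (F x).PosDef) :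
    (gaussianIntegral m P F).PosDef := by
  refine posDef_iff_dotProduct_mulVec.2 ⟨?_, fun c hc => ?_⟩
  · ext i j
    rw [conjTranspose_apply, star_trivial, gaussianIntegral, of_apply, of_apply]
    refine integral_congr_ae (ae_of_all _ fun x => ?_)
    have := (hpos x).isHermitian.apply i j
    rw [star_trivial] at this
    simp only [this]
  · rw [star_trivial, ← hF.integral_bilin]
    have hp : ∀ x, 0 < (c ⬝ᵥ (F x *ᵥ c)) * gaussianPdf m P x := fun x =>
      mul_pos (by simpa using (hpos x).dotProduct_mulVec_pos hc) (gaussianPdf_pos m hP x)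
    rw [integral_pos_iff_support_of_nonneg (fun x => (hp x).le) (hF.bilin c c),
      Function.support_eq_univ fun x => (hp x).ne']
    exact Measure.measure_univ_pos.2 (NeZero.ne _)

end Gaussian

/-! ### Jensen's inequality for the matrix inverse and determinants. -/

section Jensen

variable {n d : ℕ} {m : Fin n → ℝ} {P : Matrix (Fin n) (Fin n) ℝ}

/-- Expand `(a - Ab)ᵀ A⁻¹ (a - Ab) ≥ 0`. The right side is linear in `A` and `A⁻¹`, so the bound can
be integrated with `a`, `b` fixed. -/
theorem two_mul_dotProduct_le {A : Matrix (Fin d) (Fin d) ℝ} (hA : A.PosDef) (a b : Fin d → ℝ) :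
    2 * (a ⬝ᵥ b) ≤ a ⬝ᵥ (A⁻¹ *ᵥ a) + b ⬝ᵥ (A *ᵥ b) := by
  have h := hA.inv.posSemidef.dotProduct_mulVec_nonneg (a - A *ᵥ b)
  have h1 : A⁻¹ *ᵥ (A *ᵥ b) = b := by
    rw [mulVec_mulVec, Matrix.nonsing_inv_mul _ (isUnit_iff_ne_zero.2 hA.det_pos.ne'), one_mulVec]
  have ht : Aᵀ = A := by simpa using hA.isHermitian.eq
  have h2 : (A *ᵥ b) ⬝ᵥ (A⁻¹ *ᵥ a) = a ⬝ᵥ b := by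
    rw [← vecMul_transpose, ht, ← dotProduct_mulVec, mulVec_mulVec,
      Matrix.mul_nonsing_inv _ (isUnit_iff_ne_zero.2 hA.det_pos.ne'), one_mulVec, dotProduct_comm]
  rw [star_trivial, mulVec_sub, h1, sub_dotProduct, dotProduct_sub, dotProduct_sub, h2,
    dotProduct_comm (A *ᵥ b) b] at h
  linarith

/-- Jensen's inequality for the inverse of a positive definite random matrix. -/
theorem inv_gaussianIntegral_le (hP : P.PosDef) {F : (Fin n → ℝ) → Matrix (Fin d) (Fin d) ℝ}
    (hpos : ∀ x, (F x).PosDef) (hF : GaussianIntegrable m P F)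
    (hF' : GaussianIntegrable m P fun x => (F x)⁻¹) (a : Fin d → ℝ) :
    a ⬝ᵥ ((gaussianIntegral m P F)⁻¹ *ᵥ a) ≤
      a ⬝ᵥ (gaussianIntegral m P (fun x => (F x)⁻¹) *ᵥ a) := by
  have hC := hF.posDef hP hpos
  -- This `b` maximizes `2 aᵀb - bᵀCb`, where `C` is the integral of `F`, and the maximum is
  -- `aᵀC⁻¹a`.
  set b := (gaussianIntegral m P F)⁻¹ *ᵥ a with hb
  have hmono : ∫ x, 2 * (a ⬝ᵥ b) * gaussianPdf m P x ≤
      ∫ x, ((a ⬝ᵥ ((F x)⁻¹ *ᵥ a)) * gaussianPdf m P x +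
        (b ⬝ᵥ (F x *ᵥ b)) * gaussianPdf m P x) := by
    refine integral_mono ((integrable_gaussianPdf m hP).const_mul _)
      ((hF'.bilin a a).add (hF.bilin b b)) fun x => ?_
    simp only
    rw [← add_mul]
    exact mul_le_mul_of_nonneg_right (two_mul_dotProduct_le (hpos x) a b)
      (gaussianPdf_pos m hP x).le
  have hCb : gaussianIntegral m P F *ᵥ b = a := by
    rw [hb, mulVec_mulVec, Matrix.mul_nonsing_inv _ (isUnit_iff_ne_zero.2 hC.det_pos.ne'),
      one_mulVec]
  rw [integral_const_mul, integral_gaussianPdf m hP,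
    integral_add (hF'.bilin a a) (hF.bilin b b), hF'.integral_bilin, hF.integral_bilin, hCb,
    dotProduct_comm b a] at hmono
  linarith

/-- Evaluating at unit eigenvectors shows that every eigenvalue is at least one. -/
theorem one_le_det_of_dotProduct_le {B : Matrix (Fin d) (Fin d) ℝ} (hB : B.IsHermitian)
    (h : ∀ a, a ⬝ᵥ a ≤ a ⬝ᵥ (B *ᵥ a)) : 1 ≤ B.det := by
  rw [hB.det_eq_prod_eigenvalues]
  rw [← Finset.prod_const_one (s := Finset.univ) (ι := Fin d)]
  refine Finset.prod_le_prod (fun _ _ => zero_le_one) fun i _ => ?_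
  set w : Fin d → ℝ := (hB.eigenvectorBasis i).ofLp with hw
  have h1 : w ⬝ᵥ w = 1 := by
    have h2 : inner ℝ (hB.eigenvectorBasis i) (hB.eigenvectorBasis i) = 1 := by
      rw [real_inner_self_eq_norm_sq, hB.eigenvectorBasis.norm_eq_one, one_pow]
    rwa [EuclideanSpace.inner_eq_star_dotProduct, star_trivial] at h2
  have h3 : hB.eigenvalues i = w ⬝ᵥ (B *ᵥ w) := by
    have h4 := hB.mulVec_eigenvectorBasis i
    rw [← hw] at h4
    rw [h4, dotProduct_smul, h1, smul_eq_mul, mul_one]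
  have := h w
  rw [h1, ← h3] at this
  exact this

/-- With `A = SSᵀ`, congruence by `S⁻¹` reduces to the case where `A` is the identity. -/
theorem det_le_det_of_dotProduct_le {A B : Matrix (Fin d) (Fin d) ℝ} (hA : A.PosDef)
    (hB : B.PosDef) (h : ∀ a, a ⬝ᵥ (A *ᵥ a) ≤ a ⬝ᵥ (B *ᵥ a)) : A.det ≤ B.det := by
  obtain ⟨S, hS, rfl⟩ := exists_eq_mul_transpose hA
  have hS' := isUnit_iff_ne_zero.2 hS
  have hq : ∀ (X : Matrix (Fin d) (Fin d) ℝ) (a : Fin d → ℝ),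
      (S⁻¹ᵀ *ᵥ a) ⬝ᵥ (X *ᵥ (S⁻¹ᵀ *ᵥ a)) = a ⬝ᵥ ((S⁻¹ * X * S⁻¹ᵀ) *ᵥ a) := fun X a => by
    rw [← mulVec_mulVec, ← mulVec_mulVec, mulVec_transpose S⁻¹ a, ← dotProduct_mulVec]
  have hI : S⁻¹ * (S * Sᵀ) * S⁻¹ᵀ = 1 := by
    rw [← Matrix.mul_assoc, Matrix.nonsing_inv_mul _ hS', Matrix.one_mul, ← transpose_mul,
      Matrix.nonsing_inv_mul _ hS', transpose_one]
  have hdet : S⁻¹.det ≠ 0 := by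
    rw [det_nonsing_inv, Ring.inverse_eq_inv']
    exact inv_ne_zero hS
  have h1 := one_le_det_of_dotProduct_le (B := S⁻¹ * B * S⁻¹ᵀ)
    ((posDef_mul_mul_transpose_iff hdet).2 hB).isHermitian fun a => by
      have := h (S⁻¹ᵀ *ᵥ a)
      rwa [hq, hq, hI, one_mulVec] at this
  rw [det_mul, det_mul, det_transpose, det_nonsing_inv, Ring.inverse_eq_inv'] at h1
  rw [det_mul, det_transpose]
  have h2 : 0 < S.det * S.det := mul_self_pos.2 hS
  calc S.det * S.det = S.det * S.det * 1 := (mul_one _).symm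
    _ ≤ S.det * S.det * (S.det⁻¹ * B.det * S.det⁻¹) := mul_le_mul_of_nonneg_left h1 h2.le
    _ = B.det := by field_simp

theorem one_le_det_mul_det_gaussianIntegral (hP : P.PosDef)
    {F : (Fin n → ℝ) → Matrix (Fin d) (Fin d) ℝ} (hpos : ∀ x, (F x).PosDef)
    (hF : GaussianIntegrable m P F) (hF' : GaussianIntegrable m P fun x => (F x)⁻¹) :
    1 ≤ (gaussianIntegral m P (fun x => (F x)⁻¹) * gaussianIntegral m P F).det := by
  have hC₂ := hF.posDef hP hpos
  have h := det_le_det_of_dotProduct_le hC₂.inv (hF'.posDef hP fun x => (hpos x).inv)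
    (inv_gaussianIntegral_le hP hpos hF hF')
  rw [det_nonsing_inv, Ring.inverse_eq_inv'] at h
  rw [det_mul]
  have := mul_le_mul_of_nonneg_right h hC₂.det_pos.le
  rwa [inv_mul_cancel₀ hC₂.det_pos.ne'] at this

end Jensen

/-! ### Volume of an ellipsoid. -/

section Volume

variable {d : ℕ}

/-- With `X = BBᵀ`, the ellipsoid is the preimage of the unit ball under `B⁻¹`. The volume of the
ball is not needed. -/
theorem Vol_eq {X : Matrix (Fin d) (Fin d) ℝ} (hX : X.PosDef) :
    Vol X = ENNReal.ofReal (Real.sqrt X.det) * volume {z : Fin d → ℝ | z ⬝ᵥ z ≤ 1} := by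
  obtain ⟨B, hB, rfl⟩ := exists_eq_mul_transpose hX
  have hdet : LinearMap.det (toLin' B⁻¹) ≠ 0 := by
    rw [LinearMap.det_toLin', det_nonsing_inv, Ring.inverse_eq_inv']
    exact inv_ne_zero hB
  have hset : ellipsoid (B * Bᵀ) = toLin' B⁻¹ ⁻¹' {z : Fin d → ℝ | z ⬝ᵥ z ≤ 1} := by
    ext y
    change y ⬝ᵥ ((B * Bᵀ)⁻¹ *ᵥ y) ≤ 1 ↔ (B⁻¹ *ᵥ y) ⬝ᵥ (B⁻¹ *ᵥ y) ≤ 1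
    rw [Matrix.mul_inv_rev, ← mulVec_mulVec, dotProduct_mulVec, ← transpose_nonsing_inv,
      vecMul_transpose]
  rw [Vol, hset, Measure.addHaar_preimage_linearMap _ hdet, LinearMap.det_toLin',
    det_nonsing_inv, Ring.inverse_eq_inv', inv_inv, det_mul, det_transpose,
    Real.sqrt_mul_self_eq_abs]

end Volume

/-! ### Positivity of the parameters. -/

section Parameters

variable {n d : ℕ} {V Q : Matrix (Fin d) (Fin d) ℝ}

theorem det_one_add_mul_pos (hV : V.PosDef) (hQ : Q.PosDef) : 0 < (1 + Q * V).det := by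
  have h : 1 + Q * V = (V⁻¹ + Q) * V := by
    rw [Matrix.add_mul, Matrix.nonsing_inv_mul _ (isUnit_iff_ne_zero.2 hV.det_pos.ne')]
  rw [h, det_mul]
  exact mul_pos (hV.inv.add hQ).det_pos hV.det_pos

/-- `V(I + QV)⁻¹ = (V⁻¹ + Q)⁻¹`, which also shows the symmetry. -/
theorem Vbar_posDef (hV : V.PosDef) (hQ : Q.PosDef) : (Vbar V Q).PosDef := by
  have hu := isUnit_iff_ne_zero.2 hV.det_pos.ne'
  have h : 1 + Q * V = (V⁻¹ + Q) * V := by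
    rw [Matrix.add_mul, Matrix.nonsing_inv_mul _ hu]
  rw [Vbar, h, Matrix.mul_inv_rev, ← Matrix.mul_assoc, Matrix.mul_nonsing_inv _ hu, Matrix.one_mul]
  exact (hV.inv.add hQ).inv

theorem det_shapeH (hd : 0 < d) (hV : V.PosDef) (hQ : Q.PosDef) : (shapeH V Q).det = 1 := by
  have hD := det_one_add_mul_pos hV hQ
  rw [shapeH, det_smul, Fintype.card_fin, one_div,
    Real.rpow_inv_natCast_pow hD.le hd.ne', det_nonsing_inv, Ring.inverse_eq_inv',
    mul_inv_cancel₀ hD.ne']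

theorem scaleAt_posDef (hV : V.PosDef) (hQ : Q.PosDef)
    {M : (Fin n → ℝ) → Matrix (Fin d) (Fin d) ℝ} (hM : ∀ x, IsUnit (M x)) (x : Fin n → ℝ) :
    (scaleAt M V Q x).PosDef :=
  (posDef_mul_mul_transpose_iff ((isUnit_iff_isUnit_det _).1 (hM x)).ne_zero).2 (Vbar_posDef hV hQ)

end Parameters

end ExtentPrediction

end

/-! ### The volume identity. -/

theorem lemma6 {n d : ℕ} (hd : 0 < d)
    (m : Fin n → ℝ) (P : Matrix (Fin n) (Fin n) ℝ) (hP : P.PosDef)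
    (ν : ℝ) (V : Matrix (Fin d) (Fin d) ℝ) (hν : 2 * (d : ℝ) + 2 < ν) (hV : V.PosDef)
    (Q : Matrix (Fin d) (Fin d) ℝ) (hQ : Q.PosDef)
    (M : (Fin n → ℝ) → Matrix (Fin d) (Fin d) ℝ) (hM : ∀ x, IsUnit (M x))
    (hC₁ : ExtentPrediction.GaussianIntegrable m P
      fun x => (ExtentPrediction.scaleAt M V Q x)⁻¹)
    (hC₂ : ExtentPrediction.GaussianIntegrable m P
      fun x => ExtentPrediction.scaleAt M V Q x)
    (v ν' : ℝ) (V' H EX EX' R : Matrix (Fin d) (Fin d) ℝ)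
    (hv : v = ExtentPrediction.transDof ν V Q)
    (hν' : ν' = ExtentPrediction.predDof v m P M V Q)
    (hV' : V' = ExtentPrediction.predParam v m P M V Q)
    (hH : H = ExtentPrediction.shapeH V Q)
    (hEX : EX = ExtentPrediction.invWishartMean ν V)
    (hEX' : EX' = ExtentPrediction.invWishartMean ν' V')
    (hR : R = ExtentPrediction.gaussianIntegral m P fun x => M x * EX * H * (M x)ᵀ) :
    -- `H` lies in the special linear group
    H.det = 1 ∧
    -- the two expected extents and the integral on the right exist and describe ellipsoids
    ExtentPrediction.InvWishartMeanExists ν V ∧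
    (2 * (d : ℝ) + 2 < ν' ∧ V'.PosDef ∧ ExtentPrediction.InvWishartMeanExists ν' V') ∧
    ExtentPrediction.GaussianIntegrable m P (fun x => M x * EX * H * (M x)ᵀ) ∧
    EX'.PosDef ∧ R.PosDef ∧
    -- and the two ellipsoids have the same volume
    ExtentPrediction.Vol EX' = ExtentPrediction.Vol R := by
  have hd' : (0 : ℝ) < d := Nat.cast_pos.2 hd
  have hD := ExtentPrediction.det_one_add_mul_pos hV hQ
  have hκ : 0 < ν - 2 * d - 2 := by linarith
  have hpos := ExtentPrediction.scaleAt_posDef hV hQ hM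
  have hC₁pos : (ExtentPrediction.C₁ m P M V Q).PosDef := hC₁.posDef hP fun x => (hpos x).inv
  have hC₂pos : (ExtentPrediction.C₂ m P M V Q).PosDef := hC₂.posDef hP hpos
  have hdet : 1 ≤ (ExtentPrediction.C₁ m P M V Q * ExtentPrediction.C₂ m P M V Q).det :=
    ExtentPrediction.one_le_det_mul_det_gaussianIntegral hP hpos hC₂ hC₁
  obtain ⟨ρ, hρ⟩ : ∃ ρ : ℝ, ρ = v - 2 * d - 2 := ⟨_, rfl⟩
  have hρ' : ρ = (ν - 2 * d - 2) * (1 + Q * V).det ^ (-(1 : ℝ) / d) := by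
    rw [hρ, hv, ExtentPrediction.transDof]
    ring
  have hρpos : 0 < ρ := by
    rw [hρ']
    positivity
  obtain ⟨k, hk⟩ : ∃ k : ℝ, k =
      (ExtentPrediction.C₁ m P M V Q * ExtentPrediction.C₂ m P M V Q).det ^ ((1 : ℝ) / d) :=
    ⟨_, rfl⟩
  have hk1 : 1 ≤ k := by
    rw [hk]
    exact Real.one_le_rpow hdet (by positivity)
  have hkd : k ^ d = (ExtentPrediction.C₁ m P M V Q).det * (ExtentPrediction.C₂ m P M V Q).det := by
    rw [hk, one_div, Real.rpow_inv_natCast_pow (by linarith) hd.ne', det_mul]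
  -- Since `k ≥ 1`, the denominator is at least `d + 1`.
  have hden : 0 < (ρ + d + 1) * k - ρ := by nlinarith
  have hν'eq : ν' - 2 * d - 2 = (d + 1) * ρ / ((ρ + d + 1) * k - ρ) := by
    rw [hν', ExtentPrediction.predDof, hk, hρ]
    ring
  have hν'pos : 0 < ν' - 2 * d - 2 := by
    rw [hν'eq]
    positivity
  have hν'lt : 2 * (d : ℝ) + 2 < ν' := by linarith
  have hV'pos : V'.PosDef := by
    rw [hV', ExtentPrediction.predParam, ← hν']
    refine hC₁pos.inv.smul (div_pos ?_ ?_) <;> linarith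
  have hEXeq : EX = (ν - 2 * d - 2)⁻¹ • V := by
    rw [hEX, ExtentPrediction.invWishartMean_eq hV hν]
  have hEX'eq : EX' = (k / ρ) • (ExtentPrediction.C₁ m P M V Q)⁻¹ := by
    rw [hEX', ExtentPrediction.invWishartMean_eq hV'pos hν'lt, hV', ExtentPrediction.predParam,
      ← hν', smul_smul]
    congr 1
    -- The ratio of `ν' - d - 1` to `ν' - 2d - 2` is `(ρ + d + 1)k / ρ`, and `v - d - 1 = ρ + d + 1`
    -- cancels.
    have e1 : ν' - d - 1 = (ν' - 2 * d - 2) + (d + 1) := by ring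
    have e2 : v - d - 1 = ρ + d + 1 := by
      rw [hρ]
      ring
    rw [e1, e2, hν'eq]
    have h1 : ρ + d + 1 ≠ 0 := by positivity
    have h2 := hden.ne'
    field_simp
    ring
  have hint : (fun x => M x * EX * H * (M x)ᵀ) =
      fun x => ρ⁻¹ • ExtentPrediction.scaleAt M V Q x := by
    funext x
    -- The scalar in `H` is what turns the factor `1/(ν - 2d - 2)` of the mean into `1/ρ`.
    have hc : (ν - 2 * d - 2)⁻¹ * (1 + Q * V).det ^ ((1 : ℝ) / d) = ρ⁻¹ := by
      rw [hρ', mul_inv, neg_div, Real.rpow_neg hD.le, inv_inv]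
    rw [hEXeq, hH, ExtentPrediction.shapeH, ExtentPrediction.scaleAt, ExtentPrediction.Vbar, ← hc]
    simp only [Matrix.mul_smul, Matrix.smul_mul, smul_smul, Matrix.mul_assoc]
    rw [mul_comm]
  have hReq : R = ρ⁻¹ • ExtentPrediction.C₂ m P M V Q := by
    rw [hR, hint]
    exact ExtentPrediction.gaussianIntegral_smul _ _
  have hEX'pos : EX'.PosDef := by
    rw [hEX'eq]
    exact hC₁pos.inv.smul (by positivity)
  have hRpos : R.PosDef := by
    rw [hReq]
    exact hC₂pos.smul (by positivity)
  refine ⟨?_, ExtentPrediction.invWishartMeanExists hV hν,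
    ⟨hν'lt, hV'pos, ExtentPrediction.invWishartMeanExists hV'pos hν'lt⟩, ?_, hEX'pos, hRpos, ?_⟩
  · rw [hH, ExtentPrediction.det_shapeH hd hV hQ]
  · rw [hint]
    exact hC₂.smul _
  · rw [ExtentPrediction.Vol_eq hEX'pos, ExtentPrediction.Vol_eq hRpos]
    congr 3
    -- Both determinants equal `|C₂| / ρ^d`, because `k^d = |C₁||C₂|`.
    rw [hEX'eq, hReq, det_smul, det_smul, Fintype.card_fin, div_pow, hkd, det_nonsing_inv,
      Ring.inverse_eq_inv', inv_pow]
    have := hC₁pos.det_pos.ne'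
    field_simp
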